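/- Let $s\ge 0$ and $n\ge 1$ be integers, and let $a_i^\sim\in\mathbb C$, $a_i(\nu)\in\mathbb C$ ($0\le i\le n$, $\nu=0,1,2,\dots$) satisfy $a_n(\nu)=1$ and $a_i(\nu)-a_i^\sim=O(1/(\nu+1))$. For an integer $m\ge1$ let $V_m$ be the complex vector space of sequences $y(m),y(m+1),\dots$ with $$\sum_{k=0}^n a_k(\nu)\,y(\nu+k)=0\qquad(\nu\ge m),$$ and put $\omega_{n,y}(\nu)=\max(|y(\nu)|,\dots,|y(\nu+n-1)|)$. Let $\rho_1>\rho_2>\dots>\rho_{s+1}=0$ be such that the absolute value of every root of $T(z)=\sum_{k=0}^n a_k^\sim z^k$ is one of the $\rho_i$. Let $e_i$ and $k_i$ be the sum and the maximum of the multiplicities of the roots of $T$ of absolute value $\rho_i$ (both $0$ if there are none), let $k^\ast=k_{s+1}$, and suppose $e_i>0$ for $1\le i\le s$. Let $k=\max(k_1,\dots,k_s)$. Call $(A,m,\alpha,(V_{m,i}^\vee)_{1\le i\le s+1})$, with $A>0$, $m\ge1$, positive numbers $\alpha(\nu)\to0$ ($\nu\ge m$) and subspaces $V_{m,i}^\vee\subseteq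 V_m$, a growth decomposition if $V_m=V_{m,1}^\vee\oplus\dots\oplus V_{m,s+1}^\vee$, $\dim_{\mathbb C}V_{m,i}^\vee=e_i$ for $1\le i\le s+1$, and, for all $\nu\ge m$ and all $\theta\in\{1,\dots,s\}$, with $V_{m,\theta}^\wedge=V_{m,\theta}^\vee\oplus\dots\oplus V_{m,s+1}^\vee$, the natural projection $\pi_\theta:V_{m,\theta}^\wedge\to V_{m,\theta}^\vee$, and $g_\theta(\nu)=\ln\nu+\nu^{1-1/k_\theta}$: * $e^{-A g_\theta(\nu)}\rho_\theta^\nu\,\omega_{n,y}(m)\le\omega_{n,y}(\nu)$ for $y\in V_{m,\theta}^\vee$; * $\omega_{n,y}(\nu)\le e^{A g_\theta(\nu)}\rho_\theta^\nu\,\omega_{n,y}(m)$ and $\bigl(\omega_{n,\pi_\theta(y)}(m)-\alpha(\nu)\,\omega_{n,y}(m)\bigr)\rho_\theta^\nu e^{-A g_\theta(\nu)}\le\omega_{n,y}(\nu)$ for $y\in V_{m,\theta}^\wedge$; * if $k^\ast>0$, then $|y(\nu)|\le(A/\nu)^{\nu/k^\ast}\omega_{n,y}(m)$ for $y\in V_{m,s+1}^\vee$.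 Then a growth decomposition exists. Moreover, for every growth decomposition and every $\theta\in\{1,\dots,s\}$ there is a constant $A^\ast>0$ such that, with $V_{m,\theta}^\ast=V_{m,1}^\vee\oplus\dots\oplus V_{m,\theta}^\vee$, $$\exp\bigl(-A^\ast(\ln\nu+\nu^{1-1/k})\bigr)\,\rho_\theta^{\nu}\,\omega_{n,y}(m)\le\omega_{n,y}(\nu)\qquad\text{for all }y\in V_{m,\theta}^\ast\text{ and all }\nu\ge m.$$ -/

import Mathlib

open Filter Asymptotics Topology Polynomial

noncomputable section

namespace PoincareEq

/-- The point `ν + j` of the half-line `{m, m + 1, …}`, for `ν` in it. -/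
def shift {m : ℕ} (ν : Set.Ici m) (j : ℕ) : Set.Ici m :=
  ⟨(ν : ℕ) + j, le_trans ν.2 (Nat.le_add_right _ _)⟩

/-- The first point `m` of the half-line `{m, m + 1, …}`. -/
def start (m : ℕ) : Set.Ici m := ⟨m, le_refl m⟩

/-- `V_m`: the complex vector space of the sequences `y(m), y(m+1), …` with
`∑_{k=0}^n a_k(ν) y(ν+k) = 0` for all `ν ≥ m`. -/
def solutionSpace (n : ℕ) (a : ℕ → ℕ → ℂ) (m : ℕ) : Submodule ℂ (Set.Ici m → ℂ) where
  carrier := {y | ∀ ν : Set.Ici m, ∑ k ∈ Finset.range (n + 1), a k ν * y (shift ν k) = 0}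
  add_mem' := by
    intro y z hy hz ν
    simp only [Pi.add_apply, mul_add, Finset.sum_add_distrib]
    rw [hy ν, hz ν, add_zero]
  zero_mem' := by
    intro ν
    simp
  smul_mem' := by
    intro c y hy ν
    have h : ∀ k, a k ν * (c • y) (shift ν k) = c * (a k ν * y (shift ν k)) := by
      intro k
      simp only [Pi.smul_apply, smul_eq_mul]
      ring
    simp only [h, ← Finset.mul_sum]
    rw [hy ν, mul_zero]

/-- `ω_{n,y}(ν) = max (|y(ν)|, …, |y(ν+n-1)|)`
(the norm of a finite product is the supremum norm). -/
def omega (n : ℕ) {m : ℕ} (y : Set.Ici m → ℂ) (ν : Set.Ici m) : ℝ :=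
  ‖fun j : Fin n => y (shift ν j)‖

/-- The characteristic polynomial `T(z) = ∑_{k=0}^n a~_k z^k`. -/
def charPol (n : ℕ) (aLim : ℕ → ℂ) : ℂ[X] :=
  ∑ k ∈ Finset.range (n + 1), C (aLim k) * X ^ k

/-- The sum of the multiplicities of the roots of `T` of absolute value `r`. -/
def multSum (T : ℂ[X]) (r : ℝ) : ℕ :=
  ∑ z ∈ T.roots.toFinset.filter (fun z => ‖z‖ = r), T.rootMultiplicity z

/-- The maximum of the multiplicities of the roots of `T` of absolute value `r`
(`0` if there are none). -/
def multMax (T : ℂ[X]) (r : ℝ) : ℕ :=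
  (T.roots.toFinset.filter (fun z => ‖z‖ = r)).sup (fun z => T.rootMultiplicity z)

/-- The rate `ln ν + ν^{1 - 1/k}`. -/
def rate (k : ℕ) (ν : ℕ) : ℝ :=
  Real.log (ν : ℝ) + (ν : ℝ) ^ (1 - 1 / (k : ℝ))

/-- `V_j^∧ = V_j ⊕ … ⊕ V_{s+1}` (indices start at `0` in Lean). -/
def upperSum {s : ℕ} {M : Type*} [AddCommGroup M] [Module ℂ M]
    (V : Fin (s + 1) → Submodule ℂ M) (j : Fin (s + 1)) : Submodule ℂ M :=
  ⨆ i : Fin (s + 1), ⨆ _ : j ≤ i, V i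

/-- `V_j^* = V_1 ⊕ … ⊕ V_j` (indices start at `0` in Lean). -/
def lowerSum {s : ℕ} {M : Type*} [AddCommGroup M] [Module ℂ M]
    (V : Fin (s + 1) → Submodule ℂ M) (j : Fin (s + 1)) : Submodule ℂ M :=
  ⨆ i : Fin (s + 1), ⨆ _ : i ≤ j, V i

/-- The projection onto the `j`-th summand of an internal direct sum. Its restriction to
`upperSum V j` is the natural projection of that space onto `V j`. -/
def proj {s : ℕ} {M : Type*} [AddCommGroup M] [Module ℂ M]
    {V : Fin (s + 1) → Submodule ℂ M} (h : DirectSum.IsInternal V) (j : Fin (s + 1)) :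
    M →ₗ[ℂ] V j :=
  (DirectSum.component ℂ (Fin (s + 1)) (fun i => V i) j).comp
    (LinearEquiv.ofBijective (DirectSum.coeLinearMap V) h).symm.toLinearMap

/-- The subspaces `V 0, …, V s` of `V_m` (together with `A`, `m` and `α`) form a growth
decomposition of the solution space of the equation with coefficients `a`, whose
characteristic polynomial is `T` with roots of absolute values among `ρ 0 > … > ρ s = 0`. -/
structure IsGrowthDecomposition (n s : ℕ) (a : ℕ → ℕ → ℂ) (T : ℂ[X]) (ρ : Fin (s + 1) → ℝ)
    (A : ℝ) (m : ℕ) (α : ℕ → ℝ) (V : Fin (s + 1) → Submodule ℂ (solutionSpace n a m)) :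
    Prop where
  A_pos : 0 < A
  m_pos : 1 ≤ m
  α_pos : ∀ ν : ℕ, m ≤ ν → 0 < α ν
  α_tendsto : Tendsto α atTop (𝓝 0)
  isInternal : DirectSum.IsInternal V
  finrank_eq : ∀ i : Fin (s + 1), Module.finrank ℂ (V i) = multSum T (ρ i)
  /-- Lower bound on each of the first `s` summands. -/
  lower : ∀ θ : Fin s, ∀ y ∈ V θ.castSucc, ∀ ν : Set.Ici m,
    Real.exp (-A * rate (multMax T (ρ θ.castSucc)) ν) * ρ θ.castSucc ^ (ν : ℕ)
        * omega n (y : Set.Ici m → ℂ) (start m)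
      ≤ omega n (y : Set.Ici m → ℂ) ν
  /-- Upper bound on the sum of the summands from the `θ`-th on. -/
  upper : ∀ θ : Fin s, ∀ y ∈ upperSum V θ.castSucc, ∀ ν : Set.Ici m,
    omega n (y : Set.Ici m → ℂ) ν
      ≤ Real.exp (A * rate (multMax T (ρ θ.castSucc)) ν) * ρ θ.castSucc ^ (ν : ℕ)
        * omega n (y : Set.Ici m → ℂ) (start m)
  /-- Lower bound on the same sum, through the natural projection onto the `θ`-th summand. -/
  lower_proj : ∀ θ : Fin s, ∀ y ∈ upperSum V θ.castSucc, ∀ ν : Set.Ici m,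
    (omega n (((proj isInternal θ.castSucc y : V θ.castSucc) : solutionSpace n a m) :
          Set.Ici m → ℂ) (start m)
        - α ν * omega n (y : Set.Ici m → ℂ) (start m))
      * ρ θ.castSucc ^ (ν : ℕ) * Real.exp (-A * rate (multMax T (ρ θ.castSucc)) ν)
      ≤ omega n (y : Set.Ici m → ℂ) ν
  /-- Superexponential decay on the last summand. -/
  decay : 0 < multMax T (ρ (Fin.last s)) → ∀ y ∈ V (Fin.last s), ∀ ν : Set.Ici m,
    ‖(y : Set.Ici m → ℂ) ν‖
      ≤ (A / ((ν : ℕ) : ℝ)) ^ (((ν : ℕ) : ℝ) / (multMax T (ρ (Fin.last s)) : ℝ))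
        * omega n (y : Set.Ici m → ℂ) (start m)

end PoincareEq

end

open PoincareEq

/-! For a root z of T and j up to its multiplicity, let u_{z,j} be T/(X-z)^j, evaluated at the shift
operator and applied to a solution y. Then u_{z,j}(ν+1) = z u_{z,j}(ν) + u_{z,j-1}(ν), and
u_{z,0}(ν) is O(1/ν) times the window norm, because y solves an equation with coefficients
O(1/ν)-close to those of T. Weighting u_{z,j} by ν^{1-j/k}, with k the largest multiplicity on the
circle through z, spreads the small factor evenly along the chain. The equation becomes a diagonal
system with the roots as entries and an error O(ν^{-1/k}) in the rows of z (`exists_coord_step`). By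
partial fractions these coordinates control the window norm up to a factor of order ν
(`exists_omega_le`, `exists_norm_coord_le`).

A perturbed diagonal system with a gap at radius r preserves cones in which the coordinates above r
dominate (`high_dominates_succ`). Hence slow orbits, those of growth O(r^t), exist with arbitrary
low coordinates at time 0 and are determined by them (`exists_mem_slow`, `eq_zero_of_mem_slow`). The
summand at radius q consists of the orbits of growth O((q+γ)^t) whose coordinates below q vanish at
time 0. For q > 0 its norm sits in coordinates of modulus q, so each step multiplies it by q +
O(ν^{-1/k}). The product of such factors is q^t up to exp(±A·rate); for q = 0 the upper factors give
factorial decay.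

For the last assertion, let y lie in V_1 ⊕ … ⊕ V_θ. Its components may nearly cancel at ν, but at
some point at most O(rate) later one of them exceeds all others by a prescribed factor exp(b·rate)
(`exists_dominating`), and there y is as large as that component. Solutions grow at most
geometrically (`omega_shift_le`), so returning to ν costs only exp(O(rate)). -/

namespace PoincareEq

/-! ### Supremum norms of parts of a vector. -/

/-- The supremum norm of the part of a vector supported on `s`. -/
noncomputable def partNorm {ι : Type*} (s : Finset ι) (v : ι → ℂ) : ℝ := ‖fun i : s => v i‖

section PartNorm

variable {ι : Type*} {s : Finset ι} {v : ι → ℂ}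

lemma partNorm_nonneg : 0 ≤ partNorm s v := norm_nonneg _

lemma norm_le_partNorm {i : ι} (hi : i ∈ s) : ‖v i‖ ≤ partNorm s v :=
  norm_le_pi_norm (fun i : s => v i) ⟨i, hi⟩

lemma partNorm_le {c : ℝ} (hc : 0 ≤ c) (h : ∀ i ∈ s, ‖v i‖ ≤ c) : partNorm s v ≤ c :=
  (pi_norm_le_iff_of_nonneg hc).2 fun i => h i i.2

lemma partNorm_le_norm [Fintype ι] : partNorm s v ≤ ‖v‖ :=
  partNorm_le (norm_nonneg _) fun i _ => norm_le_pi_norm v i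

lemma partNorm_eq_zero_or : partNorm s v = 0 ∨ ∃ i ∈ s, ‖v i‖ = partNorm s v := by
  by_cases h : ∃ i ∈ s, ‖v i‖ = partNorm s v
  · exact Or.inr h
  push Not at h
  left
  rcases s.eq_empty_or_nonempty with rfl | hs
  · exact le_antisymm (partNorm_le le_rfl (by simp)) partNorm_nonneg
  · obtain ⟨i, hi, hmax⟩ := s.exists_max_image (fun i => ‖v i‖) hs
    exact absurd (le_antisymm (norm_le_partNorm hi) (partNorm_le (norm_nonneg _) hmax)) (h i hi)

lemma exists_norm_eq_pi_norm [Fintype ι] (v : ι → ℂ) : v = 0 ∨ ∃ i, ‖v i‖ = ‖v‖ := by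
  rcases isEmpty_or_nonempty ι with h | h
  · exact Or.inl (Subsingleton.elim _ _)
  · obtain ⟨i, hi⟩ := Finite.exists_max fun i => ‖v i‖
    exact Or.inr ⟨i, le_antisymm (norm_le_pi_norm v i)
      ((pi_norm_le_iff_of_nonneg (norm_nonneg _)).2 hi)⟩

end PartNorm

/-! ### Cones and slow orbits of a perturbed diagonal system. -/

section Dichotomy

variable {ι : Type*} [Fintype ι] {lam : ι → ℂ} {r γ : ℝ}

/-- The indices of the eigenvalues of absolute value above `r`. -/
noncomputable def high (lam : ι → ℂ) (r : ℝ) : Finset ι := Finset.univ.filter fun i => r < ‖lam i‖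

/-- The indices of the eigenvalues of absolute value at most `r`. -/
noncomputable def low (lam : ι → ℂ) (r : ℝ) : Finset ι := Finset.univ.filter fun i => ‖lam i‖ ≤ r

lemma mem_high {i : ι} : i ∈ high lam r ↔ r < ‖lam i‖ := by simp [high]

lemma mem_low {i : ι} : i ∈ low lam r ↔ ‖lam i‖ ≤ r := by simp [low]

/-- No eigenvalue has its absolute value within `γ` of `r`. -/
def HasGap (lam : ι → ℂ) (r γ : ℝ) : Prop := ∀ i, ‖lam i‖ ≤ r - γ ∨ r + γ ≤ ‖lam i‖

/-- The sequence `x` is a `δ`-perturbed orbit of the diagonal matrix with entries `lam`. -/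
def IsPerturbedOrbit (lam : ι → ℂ) (δ : ℝ) (x : ℕ → ι → ℂ) : Prop :=
  ∀ t i, ‖x (t + 1) i - lam i * x t i‖ ≤ δ * ‖x t‖

lemma norm_le_max_partNorm (r : ℝ) (v : ι → ℂ) :
    ‖v‖ ≤ max (partNorm (high lam r) v) (partNorm (low lam r) v) := by
  refine (pi_norm_le_iff_of_nonneg (le_max_of_le_left partNorm_nonneg)).2 fun i => ?_
  rcases lt_or_ge r ‖lam i‖ with h | h
  · exact le_max_of_le_left (norm_le_partNorm (mem_high.2 h))
  · exact le_max_of_le_right (norm_le_partNorm (mem_low.2 h))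

lemma norm_eq_partNorm_low {v : ι → ℂ}
    (h : 2 * partNorm (high lam r) v ≤ partNorm (low lam r) v) :
    ‖v‖ = partNorm (low lam r) v := by
  refine le_antisymm ((norm_le_max_partNorm r _).trans (max_le ?_ le_rfl)) partNorm_le_norm
  linarith [partNorm_nonneg (s := high lam r) (v := v)]

section Orbit

variable {x : ℕ → ι → ℂ} (hγ : 0 < γ) (hr : γ ≤ r) (hgap : HasGap lam r γ)
  (hx : IsPerturbedOrbit lam (γ / 3) x)

include hγ hgap hx

lemma le_partNorm_high_succ (t : ℕ) :
    (r + γ) * partNorm (high lam r) (x t) - γ / 3 * ‖x t‖ ≤ partNorm (high lam r) (x (t + 1)) := by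
  rcases partNorm_eq_zero_or (s := high lam r) (v := x t) with h | ⟨i, hi, h⟩
  · rw [h]
    have := partNorm_nonneg (s := high lam r) (v := x (t + 1))
    have := norm_nonneg (x t)
    nlinarith
  · have h1 := norm_le_partNorm (v := x (t + 1)) hi
    have h2 := hx t i
    have h3 : r + γ ≤ ‖lam i‖ := by
      rcases hgap i with h | h
      · linarith [mem_high.1 hi]
      · exact h
    have h4 : ‖lam i * x t i‖ - ‖x (t + 1) i - lam i * x t i‖ ≤ ‖x (t + 1) i‖ := by
      have := norm_sub_norm_le (lam i * x t i) (x (t + 1) i)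
      rw [norm_sub_rev] at this
      linarith
    rw [norm_mul, h] at h4
    have := mul_le_mul_of_nonneg_right h3 (partNorm_nonneg (s := high lam r) (v := x t))
    linarith

include hr

lemma partNorm_low_succ_le (t : ℕ) :
    partNorm (low lam r) (x (t + 1)) ≤ (r - γ) * partNorm (low lam r) (x t) + γ / 3 * ‖x t‖ := by
  have h0 : 0 ≤ (r - γ) * partNorm (low lam r) (x t) :=
    mul_nonneg (by linarith) partNorm_nonneg
  have h0' : 0 ≤ γ / 3 * ‖x t‖ := by positivity
  refine partNorm_le (by linarith) fun i hi => ?_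
  have h2 := hx t i
  have h3 : ‖lam i‖ ≤ r - γ := by
    rcases hgap i with h | h
    · exact h
    · linarith [mem_low.1 hi]
  have h4 := norm_le_norm_sub_add (x (t + 1) i) (lam i * x t i)
  rw [norm_mul] at h4
  have := mul_le_mul h3 (norm_le_partNorm (v := x t) hi) (norm_nonneg _) (by linarith)
  linarith

/-- In this cone ‖x‖ ≤ 2·high, so the error is at most (2γ/3)·high. The new high part is thus at
least (r+γ/3)·high, the new low part at most 2(r-2γ/3)·high. -/
lemma high_dominates_succ {t : ℕ}
    (h : partNorm (low lam r) (x t) ≤ 2 * partNorm (high lam r) (x t)) :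
    partNorm (low lam r) (x (t + 1)) ≤ 2 * partNorm (high lam r) (x (t + 1)) ∧
      (r + γ / 3) * partNorm (high lam r) (x t) ≤ partNorm (high lam r) (x (t + 1)) := by
  have h1 := le_partNorm_high_succ hγ hgap hx t
  have h2 := partNorm_low_succ_le hγ hr hgap hx t
  have h3 := partNorm_nonneg (s := high lam r) (v := x t)
  have hN : ‖x t‖ ≤ 2 * partNorm (high lam r) (x t) :=
    (norm_le_max_partNorm r _).trans (max_le (by linarith) h)
  have h4 := mul_le_mul_of_nonneg_left hN hγ.le
  have h5 := mul_le_mul_of_nonneg_left h (sub_nonneg.2 hr)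
  have h6 := mul_nonneg hγ.le h3
  constructor <;> nlinarith

/-- The narrower cone is also invariant: there the error is at most (γ/3)·high. Its factor 2 later
excludes that the norm is attained in a low coordinate. -/
lemma high_strongly_dominates {t : ℕ}
    (h : 2 * partNorm (low lam r) (x 0) ≤ partNorm (high lam r) (x 0)) :
    2 * partNorm (low lam r) (x t) ≤ partNorm (high lam r) (x t) := by
  induction t with
  | zero => exact h
  | succ t ih =>
    have h1 := le_partNorm_high_succ hγ hgap hx t
    have h2 := partNorm_low_succ_le hγ hr hgap hx t
    have h3 := partNorm_nonneg (s := high lam r) (v := x t)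
    have h3' := partNorm_nonneg (s := low lam r) (v := x t)
    have hN : ‖x t‖ ≤ partNorm (high lam r) (x t) :=
      (norm_le_max_partNorm r _).trans (max_le le_rfl (by linarith))
    have h4 := mul_le_mul_of_nonneg_left hN hγ.le
    have h5 := mul_le_mul_of_nonneg_left ih (sub_nonneg.2 hr)
    have h6 := mul_nonneg hγ.le h3
    nlinarith

lemma high_dominates_add {t : ℕ}
    (h : partNorm (low lam r) (x t) ≤ 2 * partNorm (high lam r) (x t)) (k : ℕ) :
    partNorm (low lam r) (x (t + k)) ≤ 2 * partNorm (high lam r) (x (t + k)) ∧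
      (r + γ / 3) ^ k * partNorm (high lam r) (x t) ≤ partNorm (high lam r) (x (t + k)) := by
  induction k with
  | zero => simpa using h
  | succ k ih =>
    obtain ⟨h1, h2⟩ := high_dominates_succ hγ hr hgap hx ih.1
    refine ⟨h1, le_trans ?_ h2⟩
    rw [pow_succ', mul_assoc]
    exact mul_le_mul_of_nonneg_left ih.2 (by linarith)

/-- Where an orbit of growth at most `r ^ t` is concerned, the low part dominates. -/
lemma low_dominates_of_growth {C : ℝ} (hC : ∀ t, ‖x t‖ ≤ C * r ^ t) (t : ℕ) :
    2 * partNorm (high lam r) (x t) ≤ partNorm (low lam r) (x t) := by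
  by_contra! hcon
  have hl := partNorm_nonneg (s := low lam r) (v := x t)
  have hpos : 0 < partNorm (high lam r) (x t) := by linarith
  have hr0 : 0 < r := lt_of_lt_of_le hγ hr
  -- Outside the asserted cone the high part grows at least like (r+γ/3)^k, which no bound of order
  -- r^k survives.
  have hbound : ∀ k : ℕ, ((r + γ / 3) / r) ^ k ≤ C * r ^ t / partNorm (high lam r) (x t) := by
    intro k
    have h1 := (high_dominates_add hγ hr hgap hx hcon.le k).2
    have h2 : partNorm (high lam r) (x (t + k)) ≤ C * r ^ (t + k) :=
      partNorm_le_norm.trans (hC _)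
    rw [div_pow, le_div_iff₀ hpos, div_mul_eq_mul_div, div_le_iff₀ (pow_pos hr0 k)]
    calc _ ≤ _ := h1
      _ ≤ _ := h2
      _ = _ := by ring
  have hgt : 1 < (r + γ / 3) / r := by rw [one_lt_div hr0]; linarith
  obtain ⟨k, hk⟩ := pow_unbounded_of_one_lt (C * r ^ t / partNorm (high lam r) (x t)) hgt
  exact absurd (hbound k) (not_le.2 hk)

/-- The norm is the low part, which each step multiplies by at most r-γ+γ/3 ≤ r. The constant is ‖x
0‖ itself; this uniformity lets slow orbits pass to limits. -/
lemma norm_le_of_low_dominates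
    (h : ∀ t, 2 * partNorm (high lam r) (x t) ≤ partNorm (low lam r) (x t)) (t : ℕ) :
    ‖x t‖ ≤ ‖x 0‖ * r ^ t := by
  induction t with
  | zero => simp
  | succ t ih =>
    have h2 := partNorm_low_succ_le hγ hr hgap hx t
    rw [norm_eq_partNorm_low (h _)] at ih ⊢
    rw [norm_eq_partNorm_low (h t)] at h2
    have h3 := mul_nonneg hγ.le (partNorm_nonneg (s := low lam r) (v := x t))
    have h4 := mul_le_mul_of_nonneg_left ih (hγ.le.trans hr)
    rw [pow_succ]
    nlinarith

end Orbit

variable {S : Type*} [AddCommGroup S] [Module ℂ S]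

/-- The elements whose orbit under `F` grows at most as fast as `r ^ t`. -/
def slow (F : ℕ → S →ₗ[ℂ] (ι → ℂ)) (r : ℝ) : Submodule ℂ S where
  carrier := {y | ∃ C : ℝ, ∀ t, ‖F t y‖ ≤ C * r ^ t}
  add_mem' := by
    rintro y z ⟨C, hC⟩ ⟨D, hD⟩
    refine ⟨C + D, fun t => ?_⟩
    rw [map_add, add_mul]
    exact (norm_add_le _ _).trans (add_le_add (hC t) (hD t))
  zero_mem' := ⟨0, fun t => by simp⟩
  smul_mem' := by
    rintro c y ⟨C, hC⟩
    refine ⟨‖c‖ * C, fun t => ?_⟩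
    rw [map_smul, norm_smul, mul_assoc]
    exact mul_le_mul_of_nonneg_left (hC t) (norm_nonneg _)

lemma slow_mono {F : ℕ → S →ₗ[ℂ] (ι → ℂ)} {r r' : ℝ} (hr : 0 ≤ r) (h : r ≤ r') :
    slow F r ≤ slow F r' := by
  rintro y ⟨C, hC⟩
  have hC0 : 0 ≤ C := by simpa using (norm_nonneg _).trans (hC 0)
  exact ⟨C, fun t => (hC t).trans
    (mul_le_mul_of_nonneg_left (pow_le_pow_left₀ hr h t) hC0)⟩

variable {F : ℕ → S →ₗ[ℂ] (ι → ℂ)} (hγ : 0 < γ) (hr : γ ≤ r) (hgap : HasGap lam r γ)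
  (hF : ∀ y, IsPerturbedOrbit lam (γ / 3) fun t => F t y)

include hγ hr hgap hF

lemma low_dominates_of_mem_slow {y : S} (hy : y ∈ slow F r) (t : ℕ) :
    2 * partNorm (high lam r) (F t y) ≤ partNorm (low lam r) (F t y) := by
  obtain ⟨C, hC⟩ := hy
  exact low_dominates_of_growth hγ hr hgap (hF y) hC t

lemma mem_slow_of_low_dominates {y : S}
    (h : ∀ t, 2 * partNorm (high lam r) (F t y) ≤ partNorm (low lam r) (F t y)) :
    y ∈ slow F r :=
  ⟨‖F 0 y‖, norm_le_of_low_dominates hγ hr hgap (hF y) h⟩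

lemma eq_zero_of_mem_slow (hF0 : Function.Bijective (F 0)) {y : S} (hy : y ∈ slow F r)
    (h : ∀ i ∈ low lam r, F 0 y i = 0) : y = 0 := by
  have h1 := norm_eq_partNorm_low (low_dominates_of_mem_slow hγ hr hgap hF hy 0)
  have h2 : partNorm (low lam r) (F 0 y) ≤ 0 :=
    partNorm_le le_rfl fun i hi => by rw [h i hi, norm_zero]
  apply hF0.1
  rw [map_zero, ← norm_le_zero_iff, h1]
  exact h2

/-- At a time `N`, some orbit has vanishing high part, while its low part was prescribed at
time `0`. -/
lemma exists_high_vanishing (hF0 : Function.Bijective (F 0)) (u : ι → ℂ) (N : ℕ) :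
    ∃ y : S, (∀ i ∈ low lam r, F 0 y i = u i) ∧ ∀ i ∈ high lam r, F N y i = 0 := by
  classical
  let G := LinearEquiv.ofBijective (F 0) hF0
  -- Mixed boundary data: high coordinates at time N, low ones at time 0. If all of them vanish, the
  -- orbit starts in the expanding cone, so its high part at time 0 vanishes too; injectivity gives
  -- surjectivity.
  let Φ : (ι → ℂ) →ₗ[ℂ] (ι → ℂ) := LinearMap.pi fun i =>
    if r < ‖lam i‖ then (LinearMap.proj i).comp ((F N).comp G.symm.toLinearMap)
    else LinearMap.proj i
  have hG : ∀ c, F 0 (G.symm c) = c := fun c => G.apply_symm_apply c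
  have hΦ1 : ∀ c i, i ∈ high lam r → Φ c i = F N (G.symm c) i := by
    intro c i hi
    simp [Φ, mem_high.1 hi]
  have hΦ2 : ∀ c i, i ∈ low lam r → Φ c i = c i := by
    intro c i hi
    simp [Φ, not_lt.2 (mem_low.1 hi)]
  have hinj : Function.Injective Φ := by
    rw [← LinearMap.ker_eq_bot, LinearMap.ker_eq_bot']
    intro c hc
    have hl : partNorm (low lam r) (F 0 (G.symm c)) ≤ 0 := by
      refine partNorm_le le_rfl fun i hi => ?_
      rw [hG, ← hΦ2 c i hi, hc]; simp
    have hh : partNorm (high lam r) (F N (G.symm c)) ≤ 0 := by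
      refine partNorm_le le_rfl fun i hi => ?_
      rw [← hΦ1 c i hi, hc]; simp
    have hh0 := partNorm_nonneg (s := high lam r) (v := F 0 (G.symm c))
    have h1 := (high_dominates_add hγ hr hgap (hF (G.symm c)) (t := 0) (by linarith) N).2
    rw [zero_add] at h1
    have hpow : 0 < (r + γ / 3) ^ N := by
      have : 0 < r := lt_of_lt_of_le hγ hr
      positivity
    have h2 : partNorm (high lam r) (F 0 (G.symm c)) ≤ 0 := by
      by_contra! h3
      have := mul_pos hpow h3
      linarith
    have h3 := norm_le_max_partNorm (lam := lam) r (F 0 (G.symm c))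
    rw [hG] at *
    exact norm_le_zero_iff.1 (h3.trans (max_le h2 hl))
  have hsurj := LinearMap.injective_iff_surjective.1 hinj
  obtain ⟨c, hc⟩ := hsurj fun i => if r < ‖lam i‖ then 0 else u i
  refine ⟨G.symm c, fun i hi => ?_, fun i hi => ?_⟩
  · rw [hG, ← hΦ2 c i hi, hc]
    simp [not_lt.2 (mem_low.1 hi)]
  · rw [← hΦ1 c i hi, hc]
    simp [mem_high.1 hi]

/-- A slow orbit with prescribed low part at time `0`. -/
lemma exists_mem_slow (hF0 : Function.Bijective (F 0)) (u : ι → ℂ) :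
    ∃ y ∈ slow F r, ∀ i ∈ low lam r, F 0 y i = u i := by
  choose y hy1 hy2 using exists_high_vanishing hγ hr hgap hF hF0 u
  let G := LinearEquiv.ofBijective (F 0) hF0
  have hG : ∀ c, F 0 (G.symm c) = c := fun c => G.apply_symm_apply c
  have hG' : ∀ y, G.symm (F 0 y) = y := fun y => G.symm_apply_apply y
  -- Violating the inequality before time N would put the orbit in the expanding cone, against its
  -- vanishing high part at time N. At t = 0 this bounds the initial vectors independently of N, so
  -- a subsequence converges.
  have hdom : ∀ N t, t ≤ N →
      2 * partNorm (high lam r) (F t (y N)) ≤ partNorm (low lam r) (F t (y N)) := by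
    intro N t htN
    by_contra! hcon
    have hl := partNorm_nonneg (s := low lam r) (v := F t (y N))
    have h1 := (high_dominates_add hγ hr hgap (hF (y N)) hcon.le (N - t)).2
    rw [Nat.add_sub_cancel' htN] at h1
    have h2 : partNorm (high lam r) (F N (y N)) ≤ 0 :=
      partNorm_le le_rfl fun i hi => by rw [hy2 N i hi, norm_zero]
    have hpow : 0 < (r + γ / 3) ^ (N - t) := by
      have : 0 < r := lt_of_lt_of_le hγ hr
      positivity
    have := mul_pos hpow (show 0 < partNorm (high lam r) (F t (y N)) by linarith)
    linarith
  have hball : ∀ N, F 0 (y N) ∈ Metric.closedBall (0 : ι → ℂ) ‖u‖ := by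
    intro N
    rw [mem_closedBall_zero_iff, norm_eq_partNorm_low (hdom N 0 (Nat.zero_le _))]
    refine partNorm_le (norm_nonneg _) fun i hi => ?_
    rw [hy1 N i hi]
    exact norm_le_pi_norm u i
  obtain ⟨c, -, φ, hφ, hlim⟩ := (isCompact_closedBall (0 : ι → ℂ) ‖u‖).tendsto_subseq hball
  have hlim' : ∀ t i, Tendsto (fun N => F t (y (φ N)) i) atTop (𝓝 (F t (G.symm c) i)) := by
    intro t i
    have hcont : Continuous ((LinearMap.proj i).comp ((F t).comp G.symm.toLinearMap)
        : (ι → ℂ) →ₗ[ℂ] ℂ) := LinearMap.continuous_of_finiteDimensional _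
    have := (hcont.tendsto c).comp hlim
    simpa [Function.comp_def, hG'] using this
  refine ⟨G.symm c, mem_slow_of_low_dominates hγ hr hgap hF fun t => ?_, fun i hi => ?_⟩
  · have hpart : ∀ s : Finset ι, Tendsto (fun N => partNorm s (F t (y (φ N)))) atTop
        (𝓝 (partNorm s (F t (G.symm c)))) := fun s =>
      (tendsto_pi_nhds.2 fun i : s => hlim' t i).norm
    refine le_of_tendsto_of_tendsto ((hpart _).const_mul 2) (hpart _) ?_
    filter_upwards [eventually_ge_atTop t] with N hN
    exact hdom _ _ (hN.trans (hφ.id_le N))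
  · refine tendsto_nhds_unique (hlim' 0 i) ?_
    simp [hy1 _ i hi]

end Dichotomy

/-! ### Orbits belonging to a single radius. -/

section Summand

variable {ι : Type*} [Fintype ι] {S : Type*} [AddCommGroup S] [Module ℂ S]

/-- The elements of growth at most `(q + γ) ^ t` whose coordinates at the eigenvalues of absolute
value below `q` vanish at time `0`. -/
def summand (F : ℕ → S →ₗ[ℂ] (ι → ℂ)) (lam : ι → ℂ) (γ q : ℝ) : Submodule ℂ S where
  carrier := {y | y ∈ slow F (q + γ) ∧ ∀ i, ‖lam i‖ < q → F 0 y i = 0}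
  add_mem' := by
    rintro y z ⟨hy, hy'⟩ ⟨hz, hz'⟩
    refine ⟨add_mem hy hz, fun i hi => ?_⟩
    rw [map_add, Pi.add_apply, hy' i hi, hz' i hi, add_zero]
  zero_mem' := ⟨zero_mem _, fun i _ => by simp⟩
  smul_mem' := by
    rintro c y ⟨hy, hy'⟩
    refine ⟨Submodule.smul_mem _ c hy, fun i hi => ?_⟩
    rw [map_smul, Pi.smul_apply, hy' i hi, smul_zero]

/-- All absolute values of eigenvalues other than `q` have distance at least `2 * γ` from `q`. -/
def IsIsolated (lam : ι → ℂ) (γ q : ℝ) : Prop :=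
  ∀ i, ‖lam i‖ ≤ q - 2 * γ ∨ ‖lam i‖ = q ∨ q + 2 * γ ≤ ‖lam i‖

variable {F : ℕ → S →ₗ[ℂ] (ι → ℂ)} {lam : ι → ℂ} {γ q : ℝ}

omit [Fintype ι] in
lemma IsIsolated.hasGap_add (h : IsIsolated lam γ q) (hγ : 0 < γ) : HasGap lam (q + γ) γ := by
  intro i
  rcases h i with h | h | h
  · left; linarith
  · left; linarith
  · right; linarith

omit [Fintype ι] in
lemma IsIsolated.hasGap_sub (h : IsIsolated lam γ q) (hγ : 0 < γ) : HasGap lam (q - γ) γ := by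
  intro i
  rcases h i with h | h | h
  · left; linarith
  · right; linarith
  · right; linarith

lemma IsIsolated.mem_low_iff (h : IsIsolated lam γ q) (hγ : 0 < γ) {i : ι} :
    i ∈ low lam (q + γ) ↔ ‖lam i‖ = q ∨ ‖lam i‖ < q := by
  rw [mem_low]
  constructor
  · intro hi
    rcases h i with h | h | h
    · right; linarith
    · left; exact h
    · linarith
  · rintro (hi | hi) <;> linarith

variable (hγ : 0 < γ) (hiso : IsIsolated lam γ q)
  (hF : ∀ y, IsPerturbedOrbit lam (γ / 3) fun t => F t y)

include hγ hiso hF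

/-- The initial coordinates of modulus q parametrise the summand: those below q are zero by
definition, and the low coordinates of a slow orbit determine it and can be prescribed. -/
lemma finrank_summand (hq : 0 ≤ q) (hF0 : Function.Bijective (F 0)) :
    Module.finrank ℂ (summand F lam γ q) = (Finset.univ.filter fun i => ‖lam i‖ = q).card := by
  have hgap := hiso.hasGap_add hγ
  let R : summand F lam γ q →ₗ[ℂ] ((Finset.univ.filter fun i => ‖lam i‖ = q) → ℂ) :=
    (LinearMap.pi fun i => (LinearMap.proj i.1).comp (F 0)).comp (summand F lam γ q).subtype
  have hR : ∀ y i, R y i = F 0 y i := fun _ _ => rfl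
  have hbij : Function.Bijective R := by
    constructor
    · rw [← LinearMap.ker_eq_bot, LinearMap.ker_eq_bot']
      intro y hy
      refine Subtype.ext (eq_zero_of_mem_slow hγ (by linarith) hgap hF hF0 y.2.1 fun i hi => ?_)
      rcases (hiso.mem_low_iff hγ).1 hi with hi | hi
      · have := congrFun hy ⟨i, by simpa using hi⟩
        rwa [hR] at this
      · exact y.2.2 i hi
    · intro u
      classical
      obtain ⟨y, hy, hy'⟩ := exists_mem_slow hγ (by linarith) hgap hF hF0
        fun i => if h : ‖lam i‖ = q then u ⟨i, by simpa using h⟩ else 0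
      refine ⟨⟨y, hy, fun i hi => ?_⟩, ?_⟩
      · rw [hy' i ((hiso.mem_low_iff hγ).2 (Or.inr hi)), dif_neg hi.ne]
      · ext ⟨i, hi⟩
        have hi' : ‖lam i‖ = q := by simpa using hi
        rw [hR]
        simp only
        rw [hy' i ((hiso.mem_low_iff hγ).2 (Or.inl hi')), dif_pos hi']
  rw [(LinearEquiv.ofBijective R hbij).finrank_eq, Module.finrank_fintype_fun_eq_card,
    Fintype.card_coe]

-- Subtract the orbit of growth O(r^t) with the same initial coordinates up to r; the difference has
-- none below q.
omit hiso in
lemma slow_le_sup_summand {r : ℝ} (hF0 : Function.Bijective (F 0)) (hr : γ ≤ r)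
    (hrq : r ≤ q + γ) (hgap : HasGap lam r γ) (hr' : ∀ i, ‖lam i‖ < q → ‖lam i‖ ≤ r) :
    slow F (q + γ) ≤ summand F lam γ q ⊔ slow F r := by
  intro y hy
  obtain ⟨w, hw, hw'⟩ := exists_mem_slow hγ hr hgap hF hF0 (F 0 y)
  rw [Submodule.mem_sup]
  refine ⟨y - w, ⟨sub_mem hy (slow_mono (by linarith) hrq hw), fun i hi => ?_⟩, w, hw, by simp⟩
  rw [map_sub, Pi.sub_apply, hw' i (mem_low.2 (hr' i hi)), sub_self]

/-- Only errors on the circle of radius q matter: for smaller eigenvalues the crude error is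
absorbed by the gap, since q-2γ+γ/3 ≤ q. This is why the rate at ρ_θ involves k_θ alone. -/
lemma norm_succ_le_of_mem_slow (hq : 0 ≤ q) {y : S} (hy : y ∈ slow F (q + γ)) {ε : ℝ}
    (hε : 0 ≤ ε) {t : ℕ}
    (h : ∀ i, ‖lam i‖ = q → ‖F (t + 1) y i - lam i * F t y i‖ ≤ ε * ‖F t y‖) :
    ‖F (t + 1) y‖ ≤ (q + ε) * ‖F t y‖ := by
  have hgap := hiso.hasGap_add hγ
  have hN := norm_nonneg (F t y)
  rw [norm_eq_partNorm_low (low_dominates_of_mem_slow hγ (by linarith) hgap hF hy (t + 1))]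
  refine partNorm_le (by positivity) fun i hi => ?_
  have h4 := norm_le_norm_sub_add (F (t + 1) y i) (lam i * F t y i)
  rw [norm_mul] at h4
  have h5 := norm_le_pi_norm (F t y) i
  have hεN := mul_nonneg hε hN
  rcases hiso i with h' | h' | h'
  · have h6 := hF y t i
    have h7 := mul_le_mul h' h5 (norm_nonneg _) ((norm_nonneg _).trans h')
    have h8 := mul_nonneg hγ.le hN
    simp only at h6
    linarith
  · have h6 := h i h'
    rw [h'] at h4
    have := mul_le_mul_of_nonneg_left h5 hq
    linarith
  · linarith [mem_low.1 hi]

/-- Cones at both radii: slowness makes the coordinates above q+γ at most half the norm, and the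
vanishing initial coordinates put the orbit in the narrow cone at q-γ, making the coordinates below
at most half as well. -/
lemma exists_norm_eq_of_mem_summand (hq : 2 * γ ≤ q) {y : S} (hy : y ∈ summand F lam γ q)
    (t : ℕ) : F t y = 0 ∨ ∃ i, ‖lam i‖ = q ∧ ‖F t y i‖ = ‖F t y‖ := by
  rcases exists_norm_eq_pi_norm (F t y) with h0 | ⟨i, hi⟩
  · exact Or.inl h0
  have h1 := low_dominates_of_mem_slow hγ (by linarith) (hiso.hasGap_add hγ) hF hy.1 t
  have h2 : 2 * partNorm (low lam (q - γ)) (F t y) ≤ partNorm (high lam (q - γ)) (F t y) := by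
    refine high_strongly_dominates (x := fun t => F t y) hγ (by linarith) (hiso.hasGap_sub hγ)
      (hF y) ?_
    have : partNorm (low lam (q - γ)) (F 0 y) ≤ 0 :=
      partNorm_le le_rfl fun i hi => by rw [hy.2 i (by linarith [mem_low.1 hi]), norm_zero]
    have := partNorm_nonneg (s := high lam (q - γ)) (v := F 0 y)
    linarith
  have h3 := partNorm_le_norm (s := low lam (q + γ)) (v := F t y)
  have h4 := partNorm_le_norm (s := high lam (q - γ)) (v := F t y)
  rcases hiso i with h' | h' | h'
  · left
    have h5 := norm_le_partNorm (s := low lam (q - γ)) (v := F t y)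
      (mem_low.2 (show ‖lam i‖ ≤ q - γ by linarith))
    rw [← norm_le_zero_iff]
    linarith
  · exact Or.inr ⟨i, h', hi⟩
  · left
    have h5 := norm_le_partNorm (s := high lam (q + γ)) (v := F t y)
      (mem_high.2 (show q + γ < ‖lam i‖ by linarith))
    rw [← norm_le_zero_iff]
    linarith

lemma le_norm_succ_of_mem_summand (hq : 2 * γ ≤ q) {y : S} (hy : y ∈ summand F lam γ q)
    {ε : ℝ} {t : ℕ}
    (h : ∀ i, ‖lam i‖ = q → ‖F (t + 1) y i - lam i * F t y i‖ ≤ ε * ‖F t y‖) :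
    (q - ε) * ‖F t y‖ ≤ ‖F (t + 1) y‖ := by
  rcases exists_norm_eq_of_mem_summand hγ hiso hF hq hy t with h0 | ⟨i, hi, hi'⟩
  · rw [h0, norm_zero, mul_zero]
    exact norm_nonneg _
  · have h4 := norm_sub_norm_le (lam i * F t y i) (F (t + 1) y i)
    rw [norm_sub_rev, norm_mul, hi, hi'] at h4
    have h5 := norm_le_pi_norm (F (t + 1) y) i
    have h6 := h i hi
    linarith

end Summand

/-! ### Splitting the orbit space by radii. -/

section Decomposition

variable {ι : Type*} [Fintype ι] {S : Type*} [AddCommGroup S] [Module ℂ S] {s : ℕ}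
  {F : ℕ → S →ₗ[ℂ] (ι → ℂ)} {lam : ι → ℂ} {γ : ℝ} {ρ : Fin (s + 1) → ℝ}

/-- The absolute values of the eigenvalues are among the nonnegative numbers `ρ 0 > … > ρ s`,
the gaps between which are at least `2 * γ`. -/
structure IsSpectrum (lam : ι → ℂ) (γ : ℝ) (ρ : Fin (s + 1) → ℝ) : Prop where
  gap : ∀ i j, i < j → ρ j + 2 * γ ≤ ρ i
  nonneg : ∀ i, 0 ≤ ρ i
  mem : ∀ i, ∃ θ, ‖lam i‖ = ρ θ

namespace IsSpectrum

variable (hsp : IsSpectrum lam γ ρ)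

include hsp

omit [Fintype ι] in
lemma isIsolated (θ : Fin (s + 1)) : IsIsolated lam γ (ρ θ) := by
  intro i
  obtain ⟨θ', h'⟩ := hsp.mem i
  rcases lt_trichotomy θ' θ with h | h | h
  · right; right; linarith [hsp.gap _ _ h]
  · right; left; rw [h', h]
  · left; linarith [hsp.gap _ _ h]

variable (hγ : 0 < γ)

include hγ

omit [Fintype ι] in
lemma strictAnti : StrictAnti ρ := fun i j h => by linarith [hsp.gap i j h]

omit [Fintype ι] in
lemma le_of_lt {θ : Fin s} {i : ι} (h : ‖lam i‖ < ρ θ.castSucc) : ‖lam i‖ ≤ ρ θ.succ := by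
  obtain ⟨θ', h'⟩ := hsp.mem i
  rw [h'] at h ⊢
  have := (hsp.strictAnti hγ).lt_iff_gt.1 h
  exact (hsp.strictAnti hγ).antitone (Fin.castSucc_lt_iff_succ_le.1 this)

variable (hF : ∀ y, IsPerturbedOrbit lam (γ / 3) fun t => F t y)
  (hF0 : Function.Bijective (F 0))

include hF hF0

lemma slow_le_iSup (θ : Fin (s + 1)) :
    slow F (ρ θ + γ) ≤ ⨆ i, summand F lam γ (ρ i) := by
  induction θ using Fin.reverseInduction with
  | last =>
    -- No eigenvalue lies below the last radius, so the vanishing condition is void there.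
    refine le_trans ?_ (le_iSup (fun i => summand F lam γ (ρ i)) (Fin.last s))
    refine fun y hy => ⟨hy, fun i hi => ?_⟩
    obtain ⟨θ, h⟩ := hsp.mem i
    have := (hsp.strictAnti hγ).antitone (Fin.le_last θ)
    linarith
  | cast θ ih =>
    have h1 := slow_le_sup_summand (q := ρ θ.castSucc) (r := ρ θ.succ + γ) hγ
      hF hF0 (by linarith [hsp.nonneg θ.succ])
      (by linarith [hsp.gap _ _ (Fin.castSucc_lt_succ (i := θ))])
      ((hsp.isIsolated _).hasGap_add hγ)
      (fun i hi => by linarith [hsp.le_of_lt hγ hi])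
    exact h1.trans (sup_le (le_iSup (fun i => summand F lam γ (ρ i)) θ.castSucc) ih)

lemma iSup_summand_eq_top : ⨆ i, summand F lam γ (ρ i) = ⊤ := by
  rw [eq_top_iff]
  intro y _
  -- All eigenvalues are below this radius, so a slow orbit can be given every initial coordinate of
  -- y and hence equals y.
  have hlow : ∀ i, i ∈ low lam (ρ 0 + γ) := by
    intro i
    obtain ⟨θ, h⟩ := hsp.mem i
    rw [mem_low, h]
    linarith [(hsp.strictAnti hγ).antitone (Fin.zero_le θ)]
  obtain ⟨w, hw, hw'⟩ := exists_mem_slow hγ (by linarith [hsp.nonneg 0])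
    ((hsp.isIsolated 0).hasGap_add hγ) hF hF0 (F 0 y)
  have : w = y := hF0.1 (funext fun i => hw' i (hlow i))
  exact hsp.slow_le_iSup hγ hF hF0 0 (this ▸ hw)

/-- The summands span, and their dimensions add up to the number of eigenvalues, so the sum is
direct. -/
lemma isInternal : DirectSum.IsInternal fun i => summand F lam γ (ρ i) := by
  have hsurj : Function.Surjective
      (DirectSum.coeLinearMap fun i => summand F lam γ (ρ i)) := by
    rw [← LinearMap.range_eq_top, DirectSum.range_coeLinearMap]
    exact hsp.iSup_summand_eq_top hγ hF hF0
  let G := LinearEquiv.ofBijective (F 0) hF0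
  have : FiniteDimensional ℂ S := G.symm.finiteDimensional
  have hS : Module.finrank ℂ S = Fintype.card ι := by
    rw [G.finrank_eq, Module.finrank_fintype_fun_eq_card]
  have hdim : Module.finrank ℂ (DirectSum _ fun i => summand F lam γ (ρ i)) =
      Module.finrank ℂ S := by
    rw [Module.finrank_directSum, hS]
    simp_rw [fun i => finrank_summand hγ (hsp.isIsolated i) hF (hsp.nonneg i) hF0]
    rw [← Finset.card_univ]
    choose f hf using hsp.mem
    rw [Finset.card_eq_sum_card_fiberwise (f := f) (t := Finset.univ) (by simp)]
    refine Finset.sum_congr rfl fun θ _ => ?_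
    congr 1
    ext i
    simp [hf, (hsp.strictAnti hγ).injective.eq_iff]
  exact ⟨(LinearMap.injective_iff_surjective_of_finrank_eq_finrank hdim).2 hsurj, hsurj⟩

omit hF0 in
lemma norm_le_of_mem_slow {θ : Fin (s + 1)} {y : S} (hy : y ∈ slow F (ρ θ + γ)) (t : ℕ) :
    ‖F t y‖ ≤ ‖F 0 y‖ * (ρ θ + γ) ^ t := by
  have hr : γ ≤ ρ θ + γ := by linarith [hsp.nonneg θ]
  have hgap := (hsp.isIsolated θ).hasGap_add hγ
  exact norm_le_of_low_dominates (x := fun t => F t y) hγ hr hgap (hF y)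
    (low_dominates_of_mem_slow hγ hr hgap hF hy) t

-- The norm of w at time 0 is attained at a low coordinate, where v vanishes. So the tail of an
-- element is bounded by the whole, with constant 1.
omit hF0 in
lemma norm_le_norm_add {θ : Fin s} {v w : S} (hv : v ∈ summand F lam γ (ρ θ.castSucc))
    (hw : w ∈ slow F (ρ θ.succ + γ)) : ‖F 0 w‖ ≤ ‖F 0 (v + w)‖ := by
  have hr : γ ≤ ρ θ.succ + γ := by linarith [hsp.nonneg θ.succ]
  have hiso := hsp.isIsolated θ.succ
  rw [norm_eq_partNorm_low
    (low_dominates_of_mem_slow hγ hr (hiso.hasGap_add hγ) hF hw 0)]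
  refine partNorm_le (norm_nonneg _) fun i hi => ?_
  have h0 : F 0 v i = 0 := by
    refine hv.2 i ?_
    have h1 := hsp.gap _ _ (Fin.castSucc_lt_succ (i := θ))
    have h2 := mem_low.1 hi
    linarith
  have := norm_le_pi_norm (F 0 (v + w)) i
  rwa [map_add, Pi.add_apply, h0, zero_add, ← map_add] at this

end IsSpectrum

end Decomposition

/-! ### Components in an internal direct sum. -/

section Projection

variable {s : ℕ} {M : Type*} [AddCommGroup M] [Module ℂ M]
  {V : Fin (s + 1) → Submodule ℂ M} (h : DirectSum.IsInternal V)

include h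

lemma sum_proj (y : M) : ∑ i, (proj h i y : M) = y := by
  classical
  have hbij : Function.Bijective (DirectSum.coeLinearMap V) := h
  have key := (LinearEquiv.ofBijective (DirectSum.coeLinearMap V) hbij).apply_symm_apply y
  rw [LinearEquiv.ofBijective_apply, DirectSum.coeLinearMap_eq_dfinsuppSum,
    DFinsupp.sum_eq_sum_fintype _ (fun _ => by simp)] at key
  exact key

lemma proj_eq_zero_of_mem {i j : Fin (s + 1)} (hij : i ≠ j) {y : M} (hy : y ∈ V i) :
    proj h j y = 0 :=
  h.ofBijective_coeLinearMap_of_mem_ne hij hy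

lemma proj_eq_zero_of_mem_upperSum {i j : Fin (s + 1)} (hij : i < j) {y : M}
    (hy : y ∈ upperSum V j) : proj h i y = 0 := by
  have : upperSum V j ≤ LinearMap.ker (proj h i) :=
    iSup_le fun k => iSup_le fun hk => fun z hz =>
      proj_eq_zero_of_mem h (hij.trans_le hk).ne' hz
  exact this hy

lemma proj_eq_zero_of_mem_lowerSum {i j : Fin (s + 1)} (hij : j < i) {y : M}
    (hy : y ∈ lowerSum V j) : proj h i y = 0 := by
  have : lowerSum V j ≤ LinearMap.ker (proj h i) :=
    iSup_le fun k => iSup_le fun hk => fun z hz =>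
      proj_eq_zero_of_mem h (hk.trans_lt hij).ne hz
  exact this hy

/-- What remains of an element of `V_j^∧` without its `j`-th component. -/
lemma sub_proj_mem {W : Submodule ℂ M} {j : Fin (s + 1)} (hW : ∀ i, j < i → V i ≤ W) {y : M}
    (hy : y ∈ upperSum V j) : y - proj h j y ∈ W := by
  conv => arg 2; arg 1; rw [← sum_proj h y]
  rw [← Finset.add_sum_erase _ _ (Finset.mem_univ j), add_sub_cancel_left]
  refine Submodule.sum_mem _ fun i hi => ?_
  rcases lt_or_gt_of_ne (Finset.ne_of_mem_erase hi) with h' | h'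
  · rw [proj_eq_zero_of_mem_upperSum h h' hy]
    simp
  · exact hW i h' (proj h i y).2

end Projection

/-! ### The rate function and products of factors q ± C ν^{-1/k}. -/

section Rate

variable {k ν : ℕ}

lemma one_sub_one_div_nonneg (hk : 1 ≤ k) : 0 ≤ 1 - 1 / (k : ℝ) := by
  have : (1 : ℝ) ≤ k := by exact_mod_cast hk
  rw [sub_nonneg, div_le_one (by linarith)]
  exact this

lemma one_le_rate (hk : 1 ≤ k) (hν : 1 ≤ ν) : 1 ≤ rate k ν := by
  have h1 : (1 : ℝ) ≤ ν := by exact_mod_cast hν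
  have h2 := Real.log_nonneg h1
  have h3 := Real.one_le_rpow h1 (one_sub_one_div_nonneg hk)
  rw [rate]
  linarith

lemma log_le_rate (k : ℕ) (ν : ℕ) : Real.log ν ≤ rate k ν := by
  rw [rate]
  linarith [Real.rpow_nonneg (Nat.cast_nonneg (α := ℝ) ν) (1 - 1 / (k : ℝ))]

lemma rate_mono {k' : ℕ} (hk : 1 ≤ k) (hkk' : k ≤ k') (hν : 1 ≤ ν) : rate k ν ≤ rate k' ν := by
  have h1 : (1 : ℝ) ≤ ν := by exact_mod_cast hν
  have h2 : (0 : ℝ) < k := by exact_mod_cast hk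
  have h3 : (k : ℝ) ≤ k' := by exact_mod_cast hkk'
  rw [rate, rate]
  have := Real.rpow_le_rpow_of_exponent_le h1
    (sub_le_sub_left (one_div_le_one_div_of_le h2 h3) 1)
  linarith

lemma rate_le_mul {ν' : ℕ} {c : ℝ} (hk : 1 ≤ k) (hν : 1 ≤ ν) (hν' : 1 ≤ ν') (hc : 1 ≤ c)
    (h : (ν' : ℝ) ≤ c * ν) : rate k ν' ≤ 2 * c * rate k ν := by
  have h1 : (1 : ℝ) ≤ ν := by exact_mod_cast hν
  have h1' : (1 : ℝ) ≤ ν' := by exact_mod_cast hν'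
  have hβ := one_sub_one_div_nonneg hk
  have h2 : Real.log ν' ≤ Real.log c + Real.log ν := by
    rw [← Real.log_mul (by linarith) (by linarith)]
    exact Real.log_le_log (by linarith) h
  have h3 : (ν' : ℝ) ^ (1 - 1 / (k : ℝ)) ≤ c * (ν : ℝ) ^ (1 - 1 / (k : ℝ)) := by
    refine (Real.rpow_le_rpow (by linarith) h hβ).trans ?_
    rw [Real.mul_rpow (by linarith) (by linarith)]
    refine mul_le_mul_of_nonneg_right ?_ (by positivity)
    calc c ^ (1 - 1 / (k : ℝ)) ≤ c ^ (1 : ℝ) := Real.rpow_le_rpow_of_exponent_le hc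
          (by linarith [show 0 ≤ 1 / (k : ℝ) by positivity])
      _ = c := Real.rpow_one c
  have h4 := Real.log_le_sub_one_of_pos (show (0 : ℝ) < c by linarith)
  have h5 := one_le_rate hk hν
  have h6 := Real.log_nonneg h1
  have h7 : 0 ≤ (ν : ℝ) ^ (1 - 1 / (k : ℝ)) := by positivity
  rw [rate] at h5 ⊢
  rw [rate]
  nlinarith

/-- The rate dominates the sums of ν^{-1/k}, which arise as exponents when the one-step factors are
multiplied. -/
lemma rate_succ (hk : 1 ≤ k) (hν : 1 ≤ ν) :
    rate k ν + 1 / 4 * (ν : ℝ) ^ (-(1 / (k : ℝ))) ≤ rate k (ν + 1) := by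
  have h1 : (1 : ℝ) ≤ ν := by exact_mod_cast hν
  have h0 : (0 : ℝ) < ν := by linarith
  -- For k = 1 the power is constant and the logarithm supplies the increment. For k ≥ 2 the power
  -- does, by Bernoulli: 1-1/k ≥ 1/2, and replacing ν+1 by ν costs another 1/2.
  rcases hk.eq_or_lt with rfl | hk2
  · have h2 := Real.one_sub_inv_le_log_of_pos (show 0 < ((ν : ℝ) + 1) / ν by positivity)
    rw [Real.log_div (by linarith) (by linarith), inv_div] at h2
    have h3 : 1 - (ν : ℝ) / (ν + 1) = 1 / (ν + 1) := by field_simp; ring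
    have h4 : 1 / 4 * (ν : ℝ)⁻¹ ≤ 1 / ((ν : ℝ) + 1) := by
      rw [← one_div, div_mul_div_comm, div_le_div_iff₀ (by positivity) (by positivity)]
      linarith
    simp only [rate]
    norm_num [Real.rpow_neg_one]
    rw [h3] at h2
    linarith
  · have hk' : (2 : ℝ) ≤ k := by exact_mod_cast hk2
    have hκ : 1 / (k : ℝ) ≤ 1 / 2 := one_div_le_one_div_of_le (by norm_num) hk'
    have hκ0 : 0 ≤ 1 / (k : ℝ) := by positivity
    set κ := 1 / (k : ℝ) with hκdef
    have h2 := rpow_one_add_le_one_add_mul_self (s := -(1 / ((ν : ℝ) + 1)))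
      (by rw [neg_le_neg_iff, div_le_one (by positivity)]; linarith)
      (show 0 ≤ 1 - κ by linarith) (by linarith)
    have h3 : 1 + -(1 / ((ν : ℝ) + 1)) = ν / (ν + 1) := by field_simp; ring
    rw [h3, Real.div_rpow h0.le (by positivity), div_le_iff₀ (by positivity)] at h2
    have h4 : ((ν : ℝ) + 1) ^ (1 - κ) * (1 / (ν + 1)) = (ν + 1) ^ (-κ) := by
      rw [show -κ = (1 - κ) - 1 by ring, Real.rpow_sub_one (by positivity)]
      ring
    have h5 : 1 / 2 * (ν : ℝ) ^ (-κ) ≤ (ν + 1) ^ (-κ) := by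
      have : (2 * (ν : ℝ)) ^ (-κ) ≤ (ν + 1) ^ (-κ) :=
        Real.rpow_le_rpow_of_nonpos (by positivity) (by linarith) (by linarith)
      refine le_trans ?_ this
      rw [Real.mul_rpow (by norm_num) h0.le]
      refine mul_le_mul_of_nonneg_right ?_ (by positivity)
      calc (1 / 2 : ℝ) = 2 ^ (-1 : ℝ) := by rw [Real.rpow_neg_one]; norm_num
        _ ≤ 2 ^ (-κ) := Real.rpow_le_rpow_of_exponent_le (by norm_num) (by linarith)
    have h6 : Real.log ν ≤ Real.log (ν + 1) := Real.log_le_log h0 (by linarith)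
    have h7 : 0 ≤ ((ν : ℝ) + 1) ^ (-κ) := by positivity
    simp only [rate, ← hκdef]
    push_cast
    nlinarith

lemma tendsto_rate_div (hk : 1 ≤ k) : Tendsto (fun ν : ℕ => rate k ν / ν) atTop (𝓝 0) := by
  have h1 : Tendsto (fun ν : ℕ => Real.log ν / ν) atTop (𝓝 0) :=
    (Real.isLittleO_log_id_atTop.tendsto_div_nhds_zero).comp tendsto_natCast_atTop_atTop
  have hk0 : (0 : ℝ) < k := by exact_mod_cast hk
  have h2 : Tendsto (fun ν : ℕ => (ν : ℝ) ^ (-(1 / (k : ℝ)))) atTop (𝓝 0) :=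
    (tendsto_rpow_neg_atTop (by positivity)).comp tendsto_natCast_atTop_atTop
  have h3 := h1.add h2
  rw [add_zero] at h3
  refine h3.congr' ?_
  filter_upwards [eventually_ge_atTop 1] with ν hν
  have h0 : (ν : ℝ) ≠ 0 := by positivity
  rw [rate, add_div, show -(1 / (k : ℝ)) = (1 - 1 / (k : ℝ)) - 1 by ring, Real.rpow_sub_one h0]

lemma tendsto_pow_mul_exp_rate (hk : 1 ≤ k) {c : ℝ} (hc : 0 < c) (hc1 : c < 1) (B : ℝ) :
    Tendsto (fun ν : ℕ => c ^ ν * Real.exp (B * rate k ν)) atTop (𝓝 0) := by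
  have h1 : Tendsto (fun ν : ℕ => Real.log c + B * (rate k ν / ν)) atTop (𝓝 (Real.log c)) := by
    simpa using ((tendsto_rate_div hk).const_mul B).const_add (Real.log c)
  have h2 := (tendsto_natCast_atTop_atTop (R := ℝ)).atTop_mul_neg (Real.log_neg hc hc1) h1
  refine (Real.tendsto_exp_atBot.comp h2).congr' ?_
  filter_upwards [eventually_ge_atTop 1] with ν hν
  have h0 : (ν : ℝ) ≠ 0 := by positivity
  rw [Function.comp_apply, mul_add, Real.exp_add, ← Real.rpow_natCast, Real.rpow_def_of_pos hc,
    mul_comm (ν : ℝ) (Real.log c)]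
  congr 2
  field_simp

lemma exp_neg_two_mul_le {x : ℝ} (h0 : 0 ≤ x) (h1 : x ≤ 1 / 2) : Real.exp (-(2 * x)) ≤ 1 - x := by
  rw [Real.exp_neg, inv_le_comm₀ (Real.exp_pos _) (by linarith)]
  refine le_trans ?_ (Real.add_one_le_exp (2 * x))
  rw [inv_le_iff_one_le_mul₀ (by linarith)]
  nlinarith

variable {m : ℕ} {N : ℕ → ℝ} {q C : ℝ}

/-- Each factor is at most q·exp(Cε/q) with ε = ν^{-1/k}, and ε is at most four times the increment
of the rate, so the exponents telescope. -/
lemma le_pow_mul_exp_rate (hk : 1 ≤ k) (hm : 1 ≤ m) (hN : ∀ t, 0 ≤ N t) (hq : 0 < q) (hC : 0 ≤ C)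
    (h : ∀ t, N (t + 1) ≤ (q + C * ((m + t : ℕ) : ℝ) ^ (-(1 / (k : ℝ)))) * N t) (t : ℕ) :
    N t ≤ q ^ t * Real.exp (4 * C / q * rate k (m + t)) * N 0 := by
  induction t with
  | zero =>
    have : 1 ≤ Real.exp (4 * C / q * rate k (m + 0)) := by
      rw [Real.one_le_exp_iff]
      have := one_le_rate (k := k) (ν := m + 0) hk hm
      positivity
    simpa using mul_le_mul_of_nonneg_right this (hN 0)
  | succ t ih =>
    set ε := ((m + t : ℕ) : ℝ) ^ (-(1 / (k : ℝ))) with hε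
    have hε0 : 0 ≤ ε := by positivity
    have h1 : q + C * ε ≤ q * Real.exp (C * ε / q) := by
      have := mul_le_mul_of_nonneg_left (Real.add_one_le_exp (C * ε / q)) hq.le
      have h2 : q * (C * ε / q + 1) = q + C * ε := by field_simp; ring
      linarith
    have h2 := rate_succ (k := k) (ν := m + t) hk (by omega)
    calc N (t + 1) ≤ (q + C * ε) * N t := h t
      _ ≤ (q * Real.exp (C * ε / q)) * (q ^ t * Real.exp (4 * C / q * rate k (m + t)) * N 0) :=
          mul_le_mul h1 ih (hN t) (by positivity)
      _ = q ^ (t + 1) * Real.exp (C * ε / q + 4 * C / q * rate k (m + t)) * N 0 := by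
          rw [Real.exp_add]; ring
      _ ≤ _ := by
          refine mul_le_mul_of_nonneg_right (mul_le_mul_of_nonneg_left ?_ (by positivity)) (hN 0)
          rw [Real.exp_le_exp, ← add_assoc]
          have h3 := mul_le_mul_of_nonneg_left h2 (show 0 ≤ 4 * C / q by positivity)
          have h4 : 4 * C / q * (rate k (m + t) + 1 / 4 * ε) =
            C * ε / q + 4 * C / q * rate k (m + t) := by field_simp; ring
          linarith

/-- The same telescoping with 1-x ≥ exp(-2x) for 0 ≤ x ≤ 1/2; this doubles the constant. -/
lemma pow_mul_exp_rate_le (hk : 1 ≤ k) (hm : 1 ≤ m) (hN : ∀ t, 0 ≤ N t) (hq : 0 < q) (hC : 0 ≤ C)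
    (hsmall : ∀ t, C * ((m + t : ℕ) : ℝ) ^ (-(1 / (k : ℝ))) ≤ q / 2)
    (h : ∀ t, (q - C * ((m + t : ℕ) : ℝ) ^ (-(1 / (k : ℝ)))) * N t ≤ N (t + 1)) (t : ℕ) :
    q ^ t * Real.exp (-(8 * C / q) * rate k (m + t)) * N 0 ≤ N t := by
  induction t with
  | zero =>
    have : Real.exp (-(8 * C / q) * rate k (m + 0)) ≤ 1 := by
      rw [Real.exp_le_one_iff, neg_mul, neg_nonpos]
      have := one_le_rate (k := k) (ν := m + 0) hk hm
      positivity
    simpa using mul_le_mul_of_nonneg_right this (hN 0)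
  | succ t ih =>
    have hs := hsmall t
    have ht := h t
    set ε := ((m + t : ℕ) : ℝ) ^ (-(1 / (k : ℝ))) with hε
    have hε0 : 0 ≤ ε := by positivity
    have h1 : q * Real.exp (-(2 * (C * ε / q))) ≤ q - C * ε := by
      have := mul_le_mul_of_nonneg_left (exp_neg_two_mul_le (x := C * ε / q) (by positivity)
        (by rw [div_le_iff₀ hq]; linarith)) hq.le
      have h2 : q * (1 - C * ε / q) = q - C * ε := by field_simp
      linarith
    have h2 := rate_succ (k := k) (ν := m + t) hk (by omega)
    calc _ ≤ q ^ (t + 1) *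
          Real.exp (-(2 * (C * ε / q)) + -(8 * C / q) * rate k (m + t)) * N 0 := by
          refine mul_le_mul_of_nonneg_right (mul_le_mul_of_nonneg_left ?_ (by positivity)) (hN 0)
          rw [Real.exp_le_exp, ← add_assoc]
          have h3 := mul_le_mul_of_nonneg_left h2 (show 0 ≤ 8 * C / q by positivity)
          have h4 : 8 * C / q * (rate k (m + t) + 1 / 4 * ε) =
            2 * (C * ε / q) + 8 * C / q * rate k (m + t) := by field_simp; ring
          linarith
      _ = (q * Real.exp (-(2 * (C * ε / q)))) *
            (q ^ t * Real.exp (-(8 * C / q) * rate k (m + t)) * N 0) := by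
          rw [Real.exp_add]; ring
      _ ≤ (q - C * ε) * N t := mul_le_mul h1 ih
          (mul_nonneg (by positivity) (hN 0)) (le_trans (by positivity) h1)
      _ ≤ _ := ht

/-- Superexponential decay from factors of order `ν ^ (-1 / k)`. -/
lemma exists_superexponential_decay (hk : 1 ≤ k) (hm : 1 ≤ m) (hC : 1 ≤ C) :
    ∃ B : ℝ, 0 < B ∧ ∀ N : ℕ → ℝ, (∀ t, 0 ≤ N t) →
      (∀ t, N (t + 1) ≤ C * ((m + t : ℕ) : ℝ) ^ (-(1 / (k : ℝ))) * N t) →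
      ∀ t, N t ≤ B ^ (m + t) * ((m + t : ℕ) : ℝ) ^ (-(((m + t : ℕ) : ℝ) / k)) * N 0 := by
  set κ := 1 / (k : ℝ) with hκ
  have hk1 : (1 : ℝ) ≤ k := by exact_mod_cast hk
  have hκ0 : 0 ≤ κ := by positivity
  have hκ1 : κ ≤ 1 := by rw [hκ, div_le_one (by linarith)]; exact hk1
  set D : ℝ := (((m - 1).factorial : ℕ) : ℝ) ^ κ with hD
  have hD1 : 1 ≤ D := Real.one_le_rpow (by exact_mod_cast Nat.factorial_pos _) hκ0
  refine ⟨D * C * Real.exp 2, by positivity, fun N hN h t => ?_⟩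
  -- The factorial to the power 1/k absorbs the factors (m+t)^{-1/k} exactly; D accounts for
  -- starting at m.
  have key : ∀ t, N t * (((m + t - 1).factorial : ℕ) : ℝ) ^ κ ≤ C ^ t * D * N 0 := by
    intro t
    induction t with
    | zero => simp [hD, mul_comm]
    | succ t ih =>
      have h1 : (m + (t + 1) - 1).factorial = (m + t) * (m + t - 1).factorial := by
        rw [show m + (t + 1) - 1 = (m + t - 1) + 1 by omega, Nat.factorial_succ,
          show m + t - 1 + 1 = m + t by omega]
      have hpos : (0 : ℝ) < ((m + t : ℕ) : ℝ) := by exact_mod_cast (by omega : 0 < m + t)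
      rw [h1, Nat.cast_mul, Real.mul_rpow (by positivity) (by positivity)]
      calc _ ≤ C * ((m + t : ℕ) : ℝ) ^ (-κ) * N t *
            (((m + t : ℕ) : ℝ) ^ κ * (((m + t - 1).factorial : ℕ) : ℝ) ^ κ) :=
            mul_le_mul_of_nonneg_right (h t) (by positivity)
        _ = C * (N t * (((m + t - 1).factorial : ℕ) : ℝ) ^ κ) *
            (((m + t : ℕ) : ℝ) ^ (-κ) * ((m + t : ℕ) : ℝ) ^ κ) := by ring
        _ = C * (N t * (((m + t - 1).factorial : ℕ) : ℝ) ^ κ) := by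
            rw [← Real.rpow_add hpos, neg_add_cancel, Real.rpow_zero, mul_one]
        _ ≤ C * (C ^ t * D * N 0) := mul_le_mul_of_nonneg_left ih (by linarith)
        _ = _ := by ring
  obtain ⟨ν, hν⟩ : ∃ ν, ν = m + t := ⟨_, rfl⟩
  have hν1 : 1 ≤ ν := by omega
  have hpos : (0 : ℝ) < (ν : ℝ) := by exact_mod_cast hν1
  -- From ν^ν/ν! ≤ e^ν; passing from ν! to (ν-1)! costs a factor ν ≤ e^ν.
  have hfact : (ν : ℝ) ^ ν ≤ Real.exp (2 * ν) * (((ν - 1).factorial : ℕ) : ℝ) := by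
    have h1 := Real.pow_div_factorial_le_exp (ν : ℝ) hpos.le ν
    rw [div_le_iff₀ (by positivity)] at h1
    have h2 : ν.factorial = ν * (ν - 1).factorial := by
      rw [← Nat.mul_factorial_pred (by omega)]
    rw [h2, Nat.cast_mul] at h1
    have h3 : (ν : ℝ) ≤ Real.exp ν := by linarith [Real.add_one_le_exp (ν : ℝ)]
    calc _ ≤ _ := h1
      _ = Real.exp ν * ν * (((ν - 1).factorial : ℕ) : ℝ) := by ring
      _ ≤ Real.exp ν * Real.exp ν * (((ν - 1).factorial : ℕ) : ℝ) := by gcongr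
      _ = _ := by rw [← Real.exp_add, two_mul]
  have hfact' : (ν : ℝ) ^ ((ν : ℝ) / k) ≤
      Real.exp (2 * ν) * (((ν - 1).factorial : ℕ) : ℝ) ^ κ := by
    have h1 := Real.rpow_le_rpow (by positivity) hfact hκ0
    rw [Real.mul_rpow (by positivity) (by positivity), ← Real.rpow_natCast, ← Real.rpow_mul hpos.le,
      ← Real.exp_mul, hκ, mul_one_div, ← hκ] at h1
    refine h1.trans (mul_le_mul_of_nonneg_right ?_ (by positivity))
    rw [Real.exp_le_exp]
    nlinarith
  have hN0 := hN 0
  have h1 := key t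
  rw [← hν] at h1 ⊢
  have h2 : N t * (ν : ℝ) ^ ((ν : ℝ) / k) ≤ (D * C * Real.exp 2) ^ ν * N 0 := by
    calc _ ≤ N t * (Real.exp (2 * ν) * (((ν - 1).factorial : ℕ) : ℝ) ^ κ) :=
          mul_le_mul_of_nonneg_left hfact' (hN t)
      _ = Real.exp (2 * ν) * (N t * (((ν - 1).factorial : ℕ) : ℝ) ^ κ) := by ring
      _ ≤ Real.exp (2 * ν) * (C ^ t * D * N 0) := by gcongr
      _ ≤ Real.exp (2 * ν) * (C ^ ν * D ^ ν * N 0) := by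
          have hCt := pow_le_pow_right₀ hC (hν ▸ Nat.le_add_left t m : t ≤ ν)
          have hDν : D ≤ D ^ ν := le_self_pow₀ hD1 (by omega)
          gcongr
      _ = _ := by
          rw [mul_pow, mul_pow, ← Real.exp_nat_mul, mul_comm 2 (ν : ℝ)]; ring
  rw [Real.rpow_neg hpos.le, mul_right_comm, ← div_eq_mul_inv, le_div_iff₀ (by positivity)]
  exact h2

end Rate

/-! ### Solutions and their initial values. -/

section Window

variable {n m : ℕ}

lemma coe_shift (ν : Set.Ici m) (j : ℕ) : ((shift ν j : Set.Ici m) : ℕ) = ν + j := rfl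

lemma coe_shift_start (m t : ℕ) : ((shift (start m) t : Set.Ici m) : ℕ) = m + t := rfl

lemma shift_shift (ν : Set.Ici m) (i j : ℕ) : shift (shift ν i) j = shift ν (i + j) :=
  Subtype.ext (Nat.add_assoc _ _ _)

lemma shift_zero (ν : Set.Ici m) : shift ν 0 = ν := rfl

lemma exists_eq_shift_start (ν : Set.Ici m) : ∃ t, ν = shift (start m) t :=
  ⟨(ν : ℕ) - m, Subtype.ext (Nat.add_sub_cancel' ν.2).symm⟩

lemma omega_nonneg (y : Set.Ici m → ℂ) (ν : Set.Ici m) : 0 ≤ omega n y ν := norm_nonneg _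

lemma norm_le_omega (y : Set.Ici m → ℂ) (ν : Set.Ici m) {j : ℕ} (hj : j < n) :
    ‖y (shift ν j)‖ ≤ omega n y ν :=
  norm_le_pi_norm (fun j : Fin n => y (shift ν j)) ⟨j, hj⟩

lemma omega_le {y : Set.Ici m → ℂ} {ν : Set.Ici m} {c : ℝ} (hc : 0 ≤ c)
    (h : ∀ j < n, ‖y (shift ν j)‖ ≤ c) : omega n y ν ≤ c :=
  (pi_norm_le_iff_of_nonneg hc).2 fun j => h j j.2

lemma omega_add_le (y z : Set.Ici m → ℂ) (ν : Set.Ici m) :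
    omega n (y + z) ν ≤ omega n y ν + omega n z ν :=
  norm_add_le (fun j : Fin n => y (shift ν j)) fun j : Fin n => z (shift ν j)

lemma omega_zero (ν : Set.Ici m) : omega n (0 : Set.Ici m → ℂ) ν = 0 := norm_zero

lemma omega_sum_le {κ : Type*} (s : Finset κ) (y : κ → Set.Ici m → ℂ) (ν : Set.Ici m) :
    omega n (∑ i ∈ s, y i) ν ≤ ∑ i ∈ s, omega n (y i) ν := by
  classical
  induction s using Finset.induction_on with
  | empty => simp [omega_zero]
  | insert i s hi ih =>
    rw [Finset.sum_insert hi, Finset.sum_insert hi]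
    exact (omega_add_le _ _ _).trans (by linarith)

/-- The initial values of a solution. -/
def window (n : ℕ) (a : ℕ → ℕ → ℂ) (m : ℕ) : solutionSpace n a m →ₗ[ℂ] (Fin n → ℂ) where
  toFun y := fun j => (y : Set.Ici m → ℂ) (shift (start m) j)
  map_add' _ _ := rfl
  map_smul' _ _ := rfl

/-- The values `y(m), y(m+1), …` of the solution with given initial values. -/
noncomputable def extend (n : ℕ) (a : ℕ → ℕ → ℂ) (m : ℕ) (u : Fin n → ℂ) : ℕ → ℂ
  | t => if h : t < n then u ⟨t, h⟩ else
      -∑ k : Fin n, a k (m + (t - n)) * extend n a m u (t - n + k)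
  decreasing_by omega

variable {a : ℕ → ℕ → ℂ} (ha_lead : ∀ ν : ℕ, a n ν = 1)

include ha_lead

lemma solution_apply_add {y : Set.Ici m → ℂ} (hy : y ∈ solutionSpace n a m) (ν : Set.Ici m) :
    y (shift ν n) = -∑ k ∈ Finset.range n, a k ν * y (shift ν k) := by
  have := hy ν
  rw [Finset.sum_range_succ, ha_lead, one_mul] at this
  exact eq_neg_of_add_eq_zero_right this

lemma window_injective : Function.Injective (window n a m) := by
  rw [← LinearMap.ker_eq_bot, LinearMap.ker_eq_bot']
  intro y hy
  have key : ∀ t, (y : Set.Ici m → ℂ) (shift (start m) t) = 0 := by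
    intro t
    induction t using Nat.strong_induction_on with
    | _ t ih =>
      rcases lt_or_ge t n with h | h
      · exact congrFun hy ⟨t, h⟩
      · obtain ⟨k, rfl⟩ := Nat.exists_eq_add_of_le' h
        rw [← shift_shift, solution_apply_add ha_lead y.2, neg_eq_zero]
        refine Finset.sum_eq_zero fun i hi => ?_
        rw [shift_shift, ih _ (by have := Finset.mem_range.1 hi; omega), mul_zero]
  refine Subtype.ext (funext fun ν => ?_)
  obtain ⟨t, rfl⟩ := exists_eq_shift_start ν
  exact key t

lemma window_surjective : Function.Surjective (window n a m) := by
  intro u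
  refine ⟨⟨fun ν => extend n a m u ((ν : ℕ) - m), fun ν => ?_⟩, funext fun j => ?_⟩
  · obtain ⟨t, rfl⟩ := exists_eq_shift_start ν
    have h1 : ∀ k, extend n a m u (((shift (shift (start m) t) k : Set.Ici m) : ℕ) - m) =
        extend n a m u (t + k) := by
      intro k
      rw [coe_shift, coe_shift_start]
      congr 1
      omega
    simp only [h1]
    rw [Finset.sum_range_succ, ha_lead, one_mul, coe_shift_start]
    conv_lhs => arg 2; rw [extend]
    rw [dif_neg (by omega), Nat.add_sub_cancel, Finset.sum_range]
    exact add_neg_cancel _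
  · change extend n a m u (((shift (start m) j : Set.Ici m) : ℕ) - m) = u j
    rw [coe_shift_start, Nat.add_sub_cancel_left, extend, dif_pos j.2]

lemma finiteDimensional_solutionSpace : FiniteDimensional ℂ (solutionSpace n a m) :=
  (LinearEquiv.ofBijective (window n a m)
    ⟨window_injective ha_lead, window_surjective ha_lead⟩).symm.finiteDimensional

lemma finrank_solutionSpace : Module.finrank ℂ (solutionSpace n a m) = n := by
  rw [(LinearEquiv.ofBijective (window n a m)
    ⟨window_injective ha_lead, window_surjective ha_lead⟩).finrank_eq]
  simp

end Window

/-! ### The characteristic polynomial. -/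

section CharPol

variable {n : ℕ} {aLim : ℕ → ℂ}

lemma coeff_charPol {k : ℕ} (hk : k ≤ n) : (charPol n aLim).coeff k = aLim k := by
  rw [charPol, finsetSum_coeff]
  simp only [coeff_C_mul, coeff_X_pow]
  rw [Finset.sum_eq_single k]
  · simp
  · intro i _ hi
    simp [hi.symm]
  · intro h
    exact absurd (Finset.mem_range.2 (by omega)) h

lemma natDegree_charPol_le : (charPol n aLim).natDegree ≤ n :=
  natDegree_sum_le_of_forall_le _ _ fun _ hi =>
    (natDegree_C_mul_X_pow_le _ _).trans (Nat.lt_succ_iff.1 (Finset.mem_range.1 hi))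

lemma natDegree_charPol (h : aLim n = 1) : (charPol n aLim).natDegree = n :=
  natDegree_charPol_le.antisymm (le_natDegree_of_ne_zero (by rw [coeff_charPol le_rfl, h]; simp))

lemma monic_charPol (h : aLim n = 1) : (charPol n aLim).Monic := by
  rw [Monic, leadingCoeff, natDegree_charPol h, coeff_charPol le_rfl, h]

end CharPol

/-! ### Partial fractions and the index set of roots with multiplicity. -/

section Cofactor

variable {T : ℂ[X]}

/-- The pairs consisting of a root of `T` and a number below its multiplicity. -/
abbrev RootIndex (T : ℂ[X]) : Type :=
  Σ z : T.roots.toFinset, Fin (Polynomial.rootMultiplicity (z : ℂ) T)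

/-- The quotient `T / (X - z) ^ j`. -/
noncomputable def cofactor (T : ℂ[X]) (z : ℂ) (j : ℕ) : ℂ[X] := T /ₘ (X - C z) ^ j

lemma cofactor_zero (T : ℂ[X]) (z : ℂ) : cofactor T z 0 = T := by simp [cofactor]

lemma cofactor_eq_of_mul_eq {z : ℂ} {j : ℕ} {q : ℂ[X]} (h : (X - C z) ^ j * q = T) :
    cofactor T z j = q := by
  rw [cofactor, ← h, mul_divByMonic_cancel_left _ ((monic_X_sub_C z).pow j)]

lemma pow_mul_cofactor {z : ℂ} {j : ℕ} (hj : j ≤ T.rootMultiplicity z) :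
    (X - C z) ^ j * cofactor T z j = T := by
  obtain ⟨q, hq⟩ := (pow_dvd_pow (X - C z) hj).trans (pow_rootMultiplicity_dvd T z)
  rw [cofactor_eq_of_mul_eq hq.symm, ← hq]

lemma mul_cofactor_succ {z : ℂ} {j : ℕ} (hj : j + 1 ≤ T.rootMultiplicity z) :
    (X - C z) * cofactor T z (j + 1) = cofactor T z j := by
  refine (cofactor_eq_of_mul_eq ?_).symm
  rw [← mul_assoc, ← pow_succ, pow_mul_cofactor hj]

lemma natDegree_cofactor_succ_lt (hT : T.natDegree ≠ 0) (z : ℂ) (j : ℕ) :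
    (cofactor T z (j + 1)).natDegree < T.natDegree := by
  rw [cofactor, natDegree_divByMonic _ ((monic_X_sub_C z).pow _),
    (monic_X_sub_C z).natDegree_pow, natDegree_X_sub_C]
  omega

lemma prod_roots_eq (hT : T.Monic) :
    ∏ z ∈ T.roots.toFinset, (X - C z) ^ T.rootMultiplicity z = T := by
  rw [← prod_multiset_root_eq_finset_root]
  exact prod_multiset_X_sub_C_of_monic_of_roots_card_eq hT
    (splits_iff_card_roots.1 (IsAlgClosed.splits T))

/-- The quotients `T / (X - z) ^ j` span the polynomials of degree below that of `T`
(partial fractions). -/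
lemma exists_eq_sum_cofactor (hT : T.Monic) {f : ℂ[X]} (hf : f.degree < T.degree) :
    ∃ c : RootIndex T → ℂ, f = ∑ i, C (c i) * cofactor T i.1 (i.2 + 1) := by
  obtain ⟨q, r, hr, hfr⟩ := eq_quo_mul_prod_pow_add_sum_rem_mul_prod_pow (s := T.roots.toFinset) f
    (g := fun z : ℂ => X - C z) (fun z _ => monic_X_sub_C z)
    (fun z _ w _ hzw => pairwise_coprime_X_sub_C Function.injective_id hzw)
    (fun z => T.rootMultiplicity z)
  rw [prod_roots_eq hT] at hfr
  have hr' : ∀ z ∈ T.roots.toFinset, ∀ j, r z j = C ((r z j).coeff 0) := fun z hz j =>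
    eq_C_of_degree_le_zero (by
      have := hr z hz j
      rw [degree_X_sub_C] at this
      exact Nat.WithBot.lt_one_iff_le_zero.1 this)
  -- The j-th power of X - z times the other root factors is T divided by (X - z)^(multiplicity -
  -- j), hence the reversal of the index.
  have hterm : ∀ z ∈ T.roots.toFinset, ∀ j : Fin (T.rootMultiplicity z),
      (X - C z) ^ (j : ℕ) * ∏ k ∈ T.roots.toFinset.erase z, (X - C k) ^ T.rootMultiplicity k =
        cofactor T z ((Fin.rev j : ℕ) + 1) := by
    intro z hz j
    refine (cofactor_eq_of_mul_eq ?_).symm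
    rw [← mul_assoc, ← pow_add, Fin.val_rev,
      show T.rootMultiplicity z - (j + 1) + 1 + j = T.rootMultiplicity z by omega,
      Finset.mul_prod_erase (f := fun k => (X - C k) ^ T.rootMultiplicity k) _ hz, prod_roots_eq hT]
  have hsum : ∑ z ∈ T.roots.toFinset, ∑ j, r z j * (X - C z) ^ (j : ℕ) *
        ∏ k ∈ T.roots.toFinset.erase z, (X - C k) ^ T.rootMultiplicity k =
      ∑ i : RootIndex T, C ((r i.1 (Fin.rev i.2)).coeff 0) * cofactor T i.1 (i.2 + 1) := by
    rw [Fintype.sum_sigma, ← Finset.sum_coe_sort]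
    refine Finset.sum_congr rfl fun z _ => ?_
    rw [← Equiv.sum_comp Fin.revPerm]
    refine Finset.sum_congr rfl fun j _ => ?_
    rw [Fin.revPerm_apply, mul_assoc, hterm z z.2, Fin.rev_rev, ← hr' z z.2]
  rw [hsum] at hfr
  have hdeg : (∑ i : RootIndex T, C ((r i.1 (Fin.rev i.2)).coeff 0) *
      cofactor T i.1 (i.2 + 1)).degree < T.degree := by
    refine (degree_sum_le _ _).trans_lt ((Finset.sup_lt_iff ?_).2 fun i _ => ?_)
    · exact bot_lt_iff_ne_bot.2 fun h => hT.ne_zero (degree_eq_bot.1 h)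
    · rw [← smul_eq_C_mul]
      refine (degree_smul_le _ _).trans_lt ?_
      rw [cofactor]
      refine degree_divByMonic_lt _ _ hT.ne_zero ?_
      rw [degree_pow, degree_X_sub_C]
      simp
      norm_cast
      omega
  -- Everything else has degree below that of T, so the multiple of T must vanish.
  have hq : q = 0 := by
    by_contra hq
    have h1 : (q * T).degree < T.degree := by
      rw [← sub_eq_iff_eq_add.2 hfr]
      exact (degree_sub_le _ _).trans_lt (max_lt hf hdeg)
    rw [degree_mul, degree_eq_natDegree hq, degree_eq_natDegree hT.ne_zero] at h1
    norm_cast at h1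
    omega
  rw [hq, zero_mul, zero_add] at hfr
  exact ⟨fun i => (r i.1 (Fin.rev i.2)).coeff 0, hfr⟩

lemma card_filter_rootIndex (T : ℂ[X]) (r : ℝ) :
    (Finset.univ.filter fun i : RootIndex T => ‖(i.1 : ℂ)‖ = r).card = multSum T r := by
  rw [Finset.card_filter, Fintype.sum_sigma, multSum, Finset.sum_filter,
    ← Finset.sum_coe_sort T.roots.toFinset]
  refine Finset.sum_congr rfl fun z _ => ?_
  split_ifs <;> simp

lemma card_rootIndex (T : ℂ[X]) : Fintype.card (RootIndex T) = T.natDegree := by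
  rw [Fintype.card_sigma, ← splits_iff_card_roots.1 (IsAlgClosed.splits T),
    ← Multiset.toFinset_sum_count_eq, ← Finset.sum_coe_sort T.roots.toFinset]
  simp only [Fintype.card_fin, count_roots]

lemma rootMultiplicity_le_multMax {z : ℂ} (hz : z ∈ T.roots.toFinset) :
    T.rootMultiplicity z ≤ multMax T ‖z‖ :=
  Finset.le_sup (f := fun z => T.rootMultiplicity z) (Finset.mem_filter.2 ⟨hz, rfl⟩)

end Cofactor
-- Polynomials in the shift operator.
section ShiftOperator

variable {m : ℕ}

/-- The operator `y(ν) ↦ y(ν + 1)`. -/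
noncomputable def shiftOp (m : ℕ) : Module.End ℂ (Set.Ici m → ℂ) :=
  LinearMap.funLeft ℂ ℂ fun ν => shift ν 1

lemma shiftOp_apply (y : Set.Ici m → ℂ) (ν : Set.Ici m) : shiftOp m y ν = y (shift ν 1) := rfl

lemma shiftOp_pow_apply (j : ℕ) (y : Set.Ici m → ℂ) (ν : Set.Ici m) :
    (shiftOp m ^ j) y ν = y (shift ν j) := by
  induction j generalizing ν with
  | zero => rfl
  | succ j ih =>
    rw [pow_succ', Module.End.mul_apply, shiftOp_apply, ih, shift_shift, add_comm]

lemma aeval_shiftOp_apply {P : ℂ[X]} {N : ℕ} (hP : P.natDegree < N) (y : Set.Ici m → ℂ)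
    (ν : Set.Ici m) :
    aeval (shiftOp m) P y ν = ∑ k ∈ Finset.range N, P.coeff k * y (shift ν k) := by
  rw [aeval_eq_sum_range' hP]
  simp [LinearMap.sum_apply, shiftOp_pow_apply]

lemma aeval_shiftOp_X_pow_apply (j : ℕ) (y : Set.Ici m → ℂ) (ν : Set.Ici m) :
    aeval (shiftOp m) (X ^ j : ℂ[X]) y ν = y (shift ν j) := by
  rw [map_pow, aeval_X, shiftOp_pow_apply]

/-- With P = T/(X-z)^{j+1} the last term is the preceding member of the chain: a Jordan block. -/
lemma aeval_shiftOp_apply_shift (P : ℂ[X]) (z : ℂ) (y : Set.Ici m → ℂ) (ν : Set.Ici m) :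
    aeval (shiftOp m) P y (shift ν 1) =
      z * aeval (shiftOp m) P y ν + aeval (shiftOp m) ((X - C z) * P) y ν := by
  rw [sub_mul, map_sub, map_mul, map_mul, aeval_X, aeval_C, LinearMap.sub_apply,
    Module.End.mul_apply, Module.End.mul_apply, Module.algebraMap_end_apply, Pi.sub_apply,
    shiftOp_apply, Pi.smul_apply, smul_eq_mul]
  ring

lemma norm_aeval_shiftOp_le {P : ℂ[X]} {n : ℕ} (hP : P.natDegree < n) (y : Set.Ici m → ℂ)
    (ν : Set.Ici m) :
    ‖aeval (shiftOp m) P y ν‖ ≤ (∑ k ∈ Finset.range n, ‖P.coeff k‖) * omega n y ν := by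
  rw [aeval_shiftOp_apply hP, Finset.sum_mul]
  refine (norm_sum_le _ _).trans (Finset.sum_le_sum fun k hk => ?_)
  rw [norm_mul]
  exact mul_le_mul_of_nonneg_left (norm_le_omega y ν (Finset.mem_range.1 hk)) (norm_nonneg _)

end ShiftOperator

/-! ### Weighted coordinates that nearly diagonalise the equation. -/

section Coordinates

/-- The exponent of the weight that balances the coordinates belonging to a multiple root. -/
noncomputable def weightExp (T : ℂ[X]) (i : RootIndex T) : ℝ :=
  1 - ((i.2 : ℕ) + 1 : ℝ) / multMax T ‖(i.1 : ℂ)‖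

/-- The weighted coordinates of a sequence at the point `m + t`. -/
noncomputable def coord (T : ℂ[X]) (m t : ℕ) : (Set.Ici m → ℂ) →ₗ[ℂ] (RootIndex T → ℂ) :=
  LinearMap.pi fun i => ((((m + t : ℕ) : ℝ) ^ weightExp T i : ℝ) : ℂ) •
    (LinearMap.proj (shift (start m) t)).comp
      (aeval (shiftOp m) (cofactor T i.1 (i.2 + 1)) : Module.End ℂ (Set.Ici m → ℂ))

variable {T : ℂ[X]} {m : ℕ}

lemma coord_apply (t : ℕ) (y : Set.Ici m → ℂ) (i : RootIndex T) :
    coord T m t y i = (((m + t : ℕ) : ℝ) ^ weightExp T i : ℝ) *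
      aeval (shiftOp m) (cofactor T i.1 (i.2 + 1)) y (shift (start m) t) := rfl

lemma norm_coord_apply (t : ℕ) (y : Set.Ici m → ℂ) (i : RootIndex T) :
    ‖coord T m t y i‖ = ((m + t : ℕ) : ℝ) ^ weightExp T i *
      ‖aeval (shiftOp m) (cofactor T i.1 (i.2 + 1)) y (shift (start m) t)‖ := by
  rw [coord_apply, norm_mul, Complex.norm_real, Real.norm_of_nonneg (by positivity)]

lemma one_le_multMax (i : RootIndex T) : 1 ≤ multMax T ‖(i.1 : ℂ)‖ := by
  have := rootMultiplicity_le_multMax i.1.2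
  have := i.2.2
  omega

lemma weightExp_nonneg (i : RootIndex T) : 0 ≤ weightExp T i := by
  have h1 := one_le_multMax i
  have h2 : (i.2 : ℕ) + 1 ≤ multMax T ‖(i.1 : ℂ)‖ :=
    (Nat.succ_le_of_lt i.2.2).trans (rootMultiplicity_le_multMax i.1.2)
  rw [weightExp, sub_nonneg, div_le_one (by exact_mod_cast h1)]
  exact_mod_cast h2

lemma weightExp_le_one (i : RootIndex T) : weightExp T i ≤ 1 := by
  rw [weightExp, sub_le_self_iff]
  positivity

lemma norm_aeval_le_norm_coord (hm : 1 ≤ m) (t : ℕ) (y : Set.Ici m → ℂ) (i : RootIndex T) :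
    ‖aeval (shiftOp m) (cofactor T i.1 (i.2 + 1)) y (shift (start m) t)‖ ≤ ‖coord T m t y‖ := by
  refine le_trans ?_ (norm_le_pi_norm _ i)
  rw [norm_coord_apply]
  refine le_mul_of_one_le_left (norm_nonneg _) (Real.one_le_rpow ?_ (weightExp_nonneg i))
  exact_mod_cast (by omega : 1 ≤ m + t)

/-- The weights have exponent at most 1, whence the factor m + t. It is later paid for by the
logarithm in the rate. -/
lemma exists_norm_coord_le (hT : T.natDegree ≠ 0) :
    ∃ C : ℝ, 1 ≤ C ∧ ∀ m : ℕ, 1 ≤ m → ∀ (t : ℕ) (y : Set.Ici m → ℂ),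
      ‖coord T m t y‖ ≤ C * (m + t : ℕ) * omega T.natDegree y (shift (start m) t) := by
  let c : RootIndex T → ℝ := fun i =>
    ∑ k ∈ Finset.range T.natDegree, ‖(cofactor T i.1 (i.2 + 1)).coeff k‖
  have hc : ∀ i, 0 ≤ c i := fun i => Finset.sum_nonneg fun _ _ => norm_nonneg _
  refine ⟨1 + ∑ i, c i, le_add_of_nonneg_right (Finset.sum_nonneg fun i _ => hc i),
    fun m hm t y => ?_⟩
  have h1 : (1 : ℝ) ≤ (m + t : ℕ) := by exact_mod_cast (by omega : 1 ≤ m + t)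
  have hω := omega_nonneg (n := T.natDegree) y (shift (start m) t)
  have hsum : 0 ≤ ∑ i, c i := Finset.sum_nonneg fun i _ => hc i
  refine (pi_norm_le_iff_of_nonneg (by positivity)).2 fun i => ?_
  rw [norm_coord_apply]
  have h2 : ((m + t : ℕ) : ℝ) ^ weightExp T i ≤ (m + t : ℕ) := by
    simpa using Real.rpow_le_rpow_of_exponent_le h1 (weightExp_le_one i)
  have h3 := norm_aeval_shiftOp_le (natDegree_cofactor_succ_lt hT (i.1 : ℂ) i.2) y
    (shift (start m) t)
  have h4 : c i ≤ 1 + ∑ i, c i := by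
    have := Finset.single_le_sum (fun i _ => hc i) (Finset.mem_univ i)
    linarith
  calc _ ≤ ((m + t : ℕ) : ℝ) * (c i * omega T.natDegree y (shift (start m) t)) :=
        mul_le_mul h2 h3 (norm_nonneg _) (by positivity)
    _ ≤ ((m + t : ℕ) : ℝ) * ((1 + ∑ i, c i) * omega T.natDegree y (shift (start m) t)) := by
        gcongr
    _ = _ := by ring

/-- The cofactors span all X^j below the degree of T, so the window is a fixed combination of the
coordinates, whose weights are at least 1. -/
lemma exists_omega_le (hT : T.Monic) :
    ∃ C : ℝ, 1 ≤ C ∧ ∀ m : ℕ, 1 ≤ m → ∀ (t : ℕ) (y : Set.Ici m → ℂ),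
      omega T.natDegree y (shift (start m) t) ≤ C * ‖coord T m t y‖ := by
  have hX : ∀ j : Fin T.natDegree, ∃ c : RootIndex T → ℂ,
      (X ^ (j : ℕ) : ℂ[X]) = ∑ i, C (c i) * cofactor T i.1 (i.2 + 1) := fun j =>
    exists_eq_sum_cofactor hT (by
      rw [degree_X_pow, degree_eq_natDegree hT.ne_zero]
      exact_mod_cast j.2)
  choose c hc using hX
  have hb : ∀ j, 0 ≤ ∑ i, ‖c j i‖ := fun j => Finset.sum_nonneg fun _ _ => norm_nonneg _
  have hb' : 0 ≤ ∑ j, ∑ i, ‖c j i‖ := Finset.sum_nonneg fun j _ => hb j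
  refine ⟨1 + ∑ j, ∑ i, ‖c j i‖, by linarith, fun m hm t y => ?_⟩
  refine omega_le (by positivity) fun j hj => ?_
  rw [← aeval_shiftOp_X_pow_apply j y, hc ⟨j, hj⟩]
  simp only [map_sum, map_mul, aeval_C, LinearMap.sum_apply, Finset.sum_apply,
    Module.End.mul_apply, Module.algebraMap_end_apply, Pi.smul_apply, smul_eq_mul]
  calc _ ≤ ∑ i, ‖c ⟨j, hj⟩ i‖ * ‖coord T m t y‖ := by
        refine (norm_sum_le _ _).trans (Finset.sum_le_sum fun i _ => ?_)
        rw [norm_mul]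
        exact mul_le_mul_of_nonneg_left (norm_aeval_le_norm_coord hm t y i) (norm_nonneg _)
    _ = (∑ i, ‖c ⟨j, hj⟩ i‖) * ‖coord T m t y‖ := by rw [Finset.sum_mul]
    _ ≤ _ := by
        refine mul_le_mul_of_nonneg_right ?_ (norm_nonneg _)
        have := Finset.single_le_sum (fun j _ => hb j) (Finset.mem_univ (⟨j, hj⟩ : Fin T.natDegree))
        linarith

/-- The perturbation of the `(z, j)`-th coordinate, for `w = u_{z,j}(ν)` and `p` the value at `ν`
of the coordinate before it. -/
lemma norm_weighted_step_le {ν β κ D M : ℝ} {z w p : ℂ} (hν : 1 ≤ ν) (hβ0 : 0 ≤ β) (hβ1 : β ≤ 1)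
    (hκ1 : κ ≤ 1) (hw : ν ^ β * ‖w‖ ≤ M)
    (hp : ν ^ β * ‖p‖ ≤ D * ν ^ (-κ) * M) :
    ‖(((ν + 1) ^ β : ℝ) : ℂ) * (z * w + p) - z * (((ν ^ β : ℝ) : ℂ) * w)‖ ≤
      (‖z‖ + 2 * D) * ν ^ (-κ) * M := by
  have hν0 : 0 < ν := by linarith
  have h1 : (ν + 1) ^ β ≤ ν ^ β * (1 + 1 / ν) := by
    have h2 := rpow_one_add_le_one_add_mul_self (s := 1 / ν)
      (by linarith [show 0 ≤ 1 / ν by positivity]) hβ0 hβ1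
    have h3 : ν + 1 = ν * (1 + 1 / ν) := by field_simp
    rw [h3, Real.mul_rpow hν0.le (by positivity)]
    refine mul_le_mul_of_nonneg_left (h2.trans ?_) (by positivity)
    have := mul_le_mul_of_nonneg_right hβ1 (show 0 ≤ 1 / ν by positivity)
    linarith
  have h1' : ν ^ β ≤ (ν + 1) ^ β := Real.rpow_le_rpow hν0.le (by linarith) hβ0
  have h4 : 1 / ν ≤ ν ^ (-κ) := by
    rw [one_div, ← Real.rpow_neg_one]
    exact Real.rpow_le_rpow_of_exponent_le hν (by linarith)
  have h5 : 1 / ν ≤ 1 := by rw [div_le_one hν0]; exact hν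
  -- Two sources of error: the drift of the weight, of relative size 1/ν ≤ ν^{-κ}, and the coupling
  -- to the preceding coordinate.
  have heq : (((ν + 1) ^ β : ℝ) : ℂ) * (z * w + p) - z * (((ν ^ β : ℝ) : ℂ) * w) =
      (((ν + 1) ^ β - ν ^ β : ℝ) : ℂ) * (z * w) + (((ν + 1) ^ β : ℝ) : ℂ) * p := by
    push_cast; ring
  rw [heq]
  refine (norm_add_le _ _).trans ?_
  rw [norm_mul, norm_mul, norm_mul, Complex.norm_real, Complex.norm_real,
    Real.norm_of_nonneg (by linarith), Real.norm_of_nonneg (by positivity)]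
  have hε : 0 ≤ ν ^ (-κ) := by positivity
  have h6 : ((ν + 1) ^ β - ν ^ β) * (‖z‖ * ‖w‖) ≤ ‖z‖ * (ν ^ (-κ) * M) := by
    calc _ ≤ ν ^ β * (1 / ν) * (‖z‖ * ‖w‖) :=
          mul_le_mul_of_nonneg_right (by linarith) (by positivity)
      _ = ‖z‖ * (1 / ν * (ν ^ β * ‖w‖)) := by ring
      _ ≤ _ := by gcongr
  have h7 : (ν + 1) ^ β * ‖p‖ ≤ 2 * (D * ν ^ (-κ) * M) := by
    calc _ ≤ ν ^ β * 2 * ‖p‖ := by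
          refine mul_le_mul_of_nonneg_right (h1.trans ?_) (norm_nonneg _)
          gcongr
          linarith
      _ = 2 * (ν ^ β * ‖p‖) := by ring
      _ ≤ _ := by gcongr
  linarith

variable {n : ℕ} {a : ℕ → ℕ → ℂ} {aLim : ℕ → ℂ}

lemma eventually_sum_norm_sub_le
    (ha : ∀ i ≤ n, (fun ν : ℕ => a i ν - aLim i) =O[atTop] (fun ν : ℕ => 1 / ((ν : ℝ) + 1))) :
    ∃ D : ℝ, 0 ≤ D ∧ ∀ᶠ ν : ℕ in atTop,
      ∑ k ∈ Finset.range n, ‖a k ν - aLim k‖ ≤ D * (1 / (ν : ℝ)) := by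
  have h : (fun ν : ℕ => ∑ k ∈ Finset.range n, ‖a k ν - aLim k‖) =O[atTop]
      (fun ν : ℕ => 1 / ((ν : ℝ) + 1)) := by
    simpa only [Finset.sum_fn] using
      IsBigO.sum fun k hk => (ha k (Finset.mem_range.1 hk).le).norm_left
  obtain ⟨D, hD, hbound⟩ := h.exists_nonneg
  refine ⟨D, hD, ?_⟩
  filter_upwards [hbound.bound, eventually_ge_atTop 1] with ν hν hν1
  have h0 : (0 : ℝ) < ν := by exact_mod_cast hν1
  refine (le_abs_self _).trans (hν.trans ?_)
  rw [Real.norm_of_nonneg (by positivity)]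
  gcongr
  linarith

lemma eq_one_of_isBigO (ha_lead : ∀ ν : ℕ, a n ν = 1)
    (ha : ∀ i ≤ n, (fun ν : ℕ => a i ν - aLim i) =O[atTop] (fun ν : ℕ => 1 / ((ν : ℝ) + 1))) :
    aLim n = 1 := by
  have h1 := (ha n le_rfl).trans_tendsto tendsto_one_div_add_atTop_nhds_zero_nat
  simp only [ha_lead] at h1
  exact (sub_eq_zero.1 (tendsto_nhds_unique tendsto_const_nhds h1)).symm

/-- On a solution, T(shift) y is the sum of the differences of coefficients times y(ν+k); the
leading terms cancel. -/
lemma norm_aeval_charPol_le (ha_lead : ∀ ν : ℕ, a n ν = 1) (h1 : aLim n = 1)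
    {y : Set.Ici m → ℂ} (hy : y ∈ solutionSpace n a m) (ν : Set.Ici m) :
    ‖aeval (shiftOp m) (charPol n aLim) y ν‖ ≤
      (∑ k ∈ Finset.range n, ‖a k ν - aLim k‖) * omega n y ν := by
  rw [aeval_shiftOp_apply (Nat.lt_succ_of_le natDegree_charPol_le), Finset.sum_range_succ,
    coeff_charPol le_rfl, h1, one_mul, solution_apply_add ha_lead hy, ← sub_eq_add_neg,
    ← Finset.sum_sub_distrib, Finset.sum_mul]
  refine (norm_sum_le _ _).trans (Finset.sum_le_sum fun k hk => ?_)
  have hk' := Finset.mem_range.1 hk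
  rw [coeff_charPol hk'.le, ← sub_mul, norm_mul, norm_sub_rev]
  exact mul_le_mul_of_nonneg_left (norm_le_omega y ν hk') (norm_nonneg _)

/-- In the weighted coordinates, the equation is a perturbation of a diagonal system. -/
lemma exists_coord_step (ha_lead : ∀ ν : ℕ, a n ν = 1)
    (ha : ∀ i ≤ n, (fun ν : ℕ => a i ν - aLim i) =O[atTop] (fun ν : ℕ => 1 / ((ν : ℝ) + 1))) :
    ∃ C : ℝ, 1 ≤ C ∧ ∀ᶠ m : ℕ in atTop, ∀ y ∈ solutionSpace n a m, ∀ t,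
      ∀ i : RootIndex (charPol n aLim),
      ‖coord (charPol n aLim) m (t + 1) y i - i.1 * coord (charPol n aLim) m t y i‖ ≤
        C * ((m + t : ℕ) : ℝ) ^ (-(1 / (multMax (charPol n aLim) ‖(i.1 : ℂ)‖ : ℝ))) *
          ‖coord (charPol n aLim) m t y‖ := by
  have h1 := eq_one_of_isBigO ha_lead ha
  obtain ⟨D, hD, hev⟩ := eventually_sum_norm_sub_le ha
  have hdeg := natDegree_charPol h1
  obtain ⟨C₁, hC₁, hω⟩ := exists_omega_le (monic_charPol h1)
  rw [hdeg] at hω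
  set T := charPol n aLim with hT
  obtain ⟨m₀, hm₀⟩ := eventually_atTop.1 hev
  have hR : 0 ≤ ∑ i : RootIndex T, ‖(i.1 : ℂ)‖ := Finset.sum_nonneg fun _ _ => norm_nonneg _
  refine ⟨∑ i : RootIndex T, ‖(i.1 : ℂ)‖ + 2 * (1 + D * C₁), by nlinarith, ?_⟩
  filter_upwards [eventually_ge_atTop m₀, eventually_ge_atTop 1] with m hmm₀ hm y hy t i
  have hν : (1 : ℝ) ≤ (m + t : ℕ) := by exact_mod_cast (by omega : 1 ≤ m + t)
  have hν0 : (0 : ℝ) < (m + t : ℕ) := by linarith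
  have hk := one_le_multMax i
  have hk' : (1 : ℝ) ≤ multMax T ‖(i.1 : ℂ)‖ := by exact_mod_cast hk
  have hstep := aeval_shiftOp_apply_shift (cofactor T i.1 (i.2 + 1)) i.1 y (shift (start m) t)
  rw [mul_cofactor_succ (Nat.succ_le_of_lt i.2.2), shift_shift] at hstep
  have hcast : ((m + (t + 1) : ℕ) : ℝ) = (m + t : ℕ) + 1 := by push_cast; ring
  have hM := norm_nonneg (coord T m t y)
  have hDC : 0 ≤ D * C₁ := by positivity
  have hw : ((m + t : ℕ) : ℝ) ^ weightExp T i *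
      ‖aeval (shiftOp m) (cofactor T i.1 (i.2 + 1)) y (shift (start m) t)‖ ≤
        ‖coord T m t y‖ := by
    rw [← norm_coord_apply]
    exact norm_le_pi_norm _ i
  have hp : ((m + t : ℕ) : ℝ) ^ weightExp T i *
      ‖aeval (shiftOp m) (cofactor T i.1 i.2) y (shift (start m) t)‖ ≤
        (1 + D * C₁) * ((m + t : ℕ) : ℝ) ^ (-(1 / (multMax T ‖(i.1 : ℂ)‖ : ℝ))) *
          ‖coord T m t y‖ := by
    obtain ⟨z, ⟨j, hj⟩⟩ := i
    -- Before the first member of the chain stands T(shift) y = O(1/ν), which against the weight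
    -- ν^{1-1/k} leaves ν^{-1/k}. Later members use that consecutive weights have ratio exactly
    -- ν^{-1/k}.
    rcases j with _ | j
    · have h2 := norm_aeval_charPol_le ha_lead h1 hy (shift (start m) t)
      have h3 := hm₀ (m + t) (by omega)
      have h4 := hω m hm t y
      have h5 : ((m + t : ℕ) : ℝ) ^ weightExp T ⟨z, ⟨0, hj⟩⟩ * (1 / ((m + t : ℕ) : ℝ)) =
          ((m + t : ℕ) : ℝ) ^ (-(1 / (multMax T ‖(z : ℂ)‖ : ℝ))) := by
        rw [mul_one_div, ← Real.rpow_sub_one hν0.ne', weightExp]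
        congr 1
        push_cast
        ring
      simp only [cofactor_zero]
      calc _ ≤ ((m + t : ℕ) : ℝ) ^ weightExp T ⟨z, ⟨0, hj⟩⟩ *
            (D * (1 / ((m + t : ℕ) : ℝ)) * (C₁ * ‖coord T m t y‖)) := by
            refine mul_le_mul_of_nonneg_left (h2.trans ?_) (by positivity)
            exact mul_le_mul h3 h4 (omega_nonneg _ _) (by positivity)
        _ = D * C₁ * (((m + t : ℕ) : ℝ) ^ weightExp T ⟨z, ⟨0, hj⟩⟩ *
              (1 / ((m + t : ℕ) : ℝ))) * ‖coord T m t y‖ := by ring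
        _ ≤ _ := by
            rw [h5]
            gcongr
            linarith
    · have hj' : j < Polynomial.rootMultiplicity (z : ℂ) T := by omega
      have h2 := norm_le_pi_norm (coord T m t y) ⟨z, ⟨j, hj'⟩⟩
      rw [norm_coord_apply] at h2
      have h5 : ((m + t : ℕ) : ℝ) ^ weightExp T ⟨z, ⟨j + 1, hj⟩⟩ =
          ((m + t : ℕ) : ℝ) ^ (-(1 / (multMax T ‖(z : ℂ)‖ : ℝ))) *
            ((m + t : ℕ) : ℝ) ^ weightExp T ⟨z, ⟨j, hj'⟩⟩ := by
        rw [← Real.rpow_add hν0, weightExp, weightExp]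
        congr 1
        push_cast
        ring
      simp only at h2 ⊢
      rw [h5, mul_assoc]
      have h6 := mul_le_mul_of_nonneg_left h2 (show 0 ≤ ((m + t : ℕ) : ℝ) ^
        (-(1 / (multMax T ‖(z : ℂ)‖ : ℝ))) by positivity)
      refine h6.trans ?_
      rw [mul_assoc]
      exact le_mul_of_one_le_left (by positivity) (by linarith)
  have key := norm_weighted_step_le (z := (i.1 : ℂ)) hν (weightExp_nonneg i) (weightExp_le_one i)
    (show 1 / (multMax T ‖(i.1 : ℂ)‖ : ℝ) ≤ 1 by rw [div_le_one (by linarith)]; exact hk')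
    hw hp
  rw [coord_apply, coord_apply, hstep, hcast]
  refine key.trans ?_
  gcongr
  exact Finset.single_le_sum (f := fun i : RootIndex T => ‖(i.1 : ℂ)‖)
    (fun _ _ => norm_nonneg _) (Finset.mem_univ i)

/-- Vanishing coordinates force a vanishing window, and both spaces have dimension n. -/
lemma coord_bijective (ha_lead : ∀ ν : ℕ, a n ν = 1) (h1 : aLim n = 1) (hm : 1 ≤ m) :
    Function.Bijective ((coord (charPol n aLim) m 0).comp (solutionSpace n a m).subtype) := by
  have hinj : Function.Injective
      ((coord (charPol n aLim) m 0).comp (solutionSpace n a m).subtype) := by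
    rw [← LinearMap.ker_eq_bot, LinearMap.ker_eq_bot']
    intro y hy
    obtain ⟨C, -, hC⟩ := exists_omega_le (monic_charPol (n := n) h1)
    rw [natDegree_charPol h1] at hC
    have h2 := hC m hm 0 y
    rw [show coord (charPol n aLim) m 0 (y : Set.Ici m → ℂ) = 0 from hy, norm_zero, mul_zero] at h2
    refine window_injective ha_lead ?_
    rw [map_zero]
    exact norm_le_zero_iff.1 h2
  have := finiteDimensional_solutionSpace (m := m) ha_lead
  refine ⟨hinj, (LinearMap.injective_iff_surjective_of_finrank_eq_finrank ?_).1 hinj⟩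
  rw [finrank_solutionSpace ha_lead, Module.finrank_fintype_fun_eq_card, card_rootIndex,
    natDegree_charPol h1]

end Coordinates

/-! ### Solutions as perturbed orbits. -/

lemma omega_neg {n m : ℕ} (y : Set.Ici m → ℂ) (ν : Set.Ici m) : omega n (-y) ν = omega n y ν :=
  norm_neg fun j : Fin n => y (shift ν j)

lemma omega_sub_le {n m : ℕ} (y z : Set.Ici m → ℂ) (ν : Set.Ici m) :
    omega n (y - z) ν ≤ omega n y ν + omega n z ν := by
  rw [sub_eq_add_neg, ← omega_neg z]
  exact omega_add_le _ _ _

lemma le_exp_mul {D x : ℝ} (hD : 0 ≤ D) (hx : 1 ≤ x) : D ≤ Real.exp (D * x) := by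
  have h1 := Real.add_one_le_exp (D * x)
  nlinarith

lemma exists_rootIndex {T : ℂ[X]} {r : ℝ} (h : 0 < multSum T r) :
    ∃ i : RootIndex T, ‖(i.1 : ℂ)‖ = r := by
  rw [← card_filter_rootIndex, Finset.card_pos] at h
  obtain ⟨i, hi⟩ := h
  exact ⟨i, by simpa using hi⟩

lemma one_le_multMax_of_pos {T : ℂ[X]} {r : ℝ} (h : 0 < multSum T r) : 1 ≤ multMax T r := by
  obtain ⟨i, rfl⟩ := exists_rootIndex h
  exact one_le_multMax i

/-- The weighted coordinates of the solutions. -/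
noncomputable def solCoord (n : ℕ) (a : ℕ → ℕ → ℂ) (T : ℂ[X]) (m t : ℕ) :
    solutionSpace n a m →ₗ[ℂ] (RootIndex T → ℂ) :=
  (coord T m t).comp (solutionSpace n a m).subtype

/-- The root belonging to an index. -/
def root (T : ℂ[X]) (i : RootIndex T) : ℂ := i.1

/-- In the weighted coordinates the equation is, from `m` on, a small perturbation of a diagonal
system with spectrum in the circles of radii `ρ`. -/
structure IsBalanced (n : ℕ) {s : ℕ} (a : ℕ → ℕ → ℂ) (T : ℂ[X]) (ρ : Fin (s + 1) → ℝ) (m : ℕ)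
    (γ C D : ℝ) : Prop where
  n_pos : 1 ≤ n
  m_pos : 1 ≤ m
  γ_pos : 0 < γ
  one_le_C : 1 ≤ C
  one_le_D : 1 ≤ D
  spectrum : IsSpectrum (root T) γ ρ
  step : ∀ y t i, ‖solCoord n a T m (t + 1) y i - root T i * solCoord n a T m t y i‖ ≤
    C * ((m + t : ℕ) : ℝ) ^ (-(1 / (multMax T ‖root T i‖ : ℝ))) * ‖solCoord n a T m t y‖
  small : ∀ i t, C * ((m + t : ℕ) : ℝ) ^ (-(1 / (multMax T ‖root T i‖ : ℝ))) ≤ γ / 3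
  bijective : Function.Bijective (solCoord n a T m 0)
  omega_le : ∀ (y : solutionSpace n a m) t,
    omega n (y : Set.Ici m → ℂ) (shift (start m) t) ≤ D * ‖solCoord n a T m t y‖
  norm_le : ∀ (y : solutionSpace n a m) t,
    ‖solCoord n a T m t y‖ ≤ D * (m + t : ℕ) * omega n (y : Set.Ici m → ℂ) (shift (start m) t)

lemma exists_gap {s : ℕ} {ρ : Fin (s + 1) → ℝ} (hρ : StrictAnti ρ) :
    ∃ γ : ℝ, 0 < γ ∧ ∀ i j, i < j → ρ j + 2 * γ ≤ ρ i := by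
  have h : ∀ᶠ γ : ℝ in 𝓝[>] 0, ∀ i j, i < j → ρ j + 2 * γ ≤ ρ i := by
    refine eventually_all.2 fun i => eventually_all.2 fun j => ?_
    by_cases hij : i < j
    · have hc : Tendsto (fun γ : ℝ => ρ j + 2 * γ) (𝓝[>] 0) (𝓝 (ρ j + 2 * 0)) :=
        (Continuous.tendsto (by fun_prop) 0).mono_left nhdsWithin_le_nhds
      filter_upwards [hc.eventually_lt_const (show ρ j + 2 * 0 < ρ i by simpa using hρ hij)]
        with γ hγ _ using hγ.le
    · exact Eventually.of_forall fun γ h => absurd h hij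
  obtain ⟨γ, h1, h2⟩ := (h.and self_mem_nhdsWithin).exists
  exact ⟨γ, h2, h1⟩

section

variable {n s : ℕ} {a : ℕ → ℕ → ℂ} {aLim : ℕ → ℂ} {ρ : Fin (s + 1) → ℝ}

lemma exists_isBalanced (hn : 1 ≤ n) (ha_lead : ∀ ν : ℕ, a n ν = 1)
    (ha : ∀ i ≤ n, (fun ν : ℕ => a i ν - aLim i) =O[atTop] (fun ν : ℕ => 1 / ((ν : ℝ) + 1)))
    (hρ : StrictAnti ρ) (hρ_last : ρ (Fin.last s) = 0)
    (hroots : ∀ z ∈ (charPol n aLim).roots, ∃ i : Fin (s + 1), ‖z‖ = ρ i) :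
    ∃ m γ C D, IsBalanced n a (charPol n aLim) ρ m γ C D := by
  obtain ⟨γ, hγ, hgap⟩ := exists_gap hρ
  have h1 := eq_one_of_isBigO ha_lead ha
  obtain ⟨C, hC, hstep⟩ := exists_coord_step ha_lead ha
  have hdeg := natDegree_charPol (n := n) h1
  obtain ⟨D₁, hD₁, hω⟩ := exists_omega_le (monic_charPol (n := n) h1)
  obtain ⟨D₂, hD₂, hN⟩ := exists_norm_coord_le (T := charPol n aLim) (by omega)
  rw [hdeg] at hω hN
  set T := charPol n aLim
  have hsmall : ∀ᶠ m : ℕ in atTop, ∀ i : RootIndex T,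
      C * ((m : ℕ) : ℝ) ^ (-(1 / (multMax T ‖root T i‖ : ℝ))) ≤ γ / 3 := by
    refine eventually_all.2 fun i => ?_
    have hk : (0 : ℝ) < multMax T ‖root T i‖ := by exact_mod_cast one_le_multMax i
    have hlim : Tendsto (fun m : ℕ => C * (m : ℝ) ^ (-(1 / (multMax T ‖root T i‖ : ℝ)))) atTop
        (𝓝 (C * 0)) :=
      ((tendsto_rpow_neg_atTop (by positivity)).comp tendsto_natCast_atTop_atTop).const_mul C
    rw [mul_zero] at hlim
    exact (hlim.eventually_lt_const (show 0 < γ / 3 by positivity)).mono fun _ h => h.le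
  obtain ⟨m, hm1, hm2, hm3⟩ :=
    (hstep.and ((eventually_forall_ge_atTop.2 hsmall).and (eventually_ge_atTop 1))).exists
  refine ⟨m, γ, C, max D₁ D₂, hn, hm3, hγ, hC, le_max_of_le_left hD₁, ⟨hgap, fun i => ?_,
    fun i => hroots _ (Multiset.mem_toFinset.1 i.1.2)⟩, fun y t i => hm1 y y.2 t i,
    fun i t => hm2 (m + t) (by omega) i, coord_bijective ha_lead h1 hm3, fun y t => ?_,
    fun y t => ?_⟩
  · rw [← hρ_last]
    exact hρ.antitone (Fin.le_last i)
  · exact (hω m hm3 t y).trans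
      (mul_le_mul_of_nonneg_right (le_max_left _ _) (norm_nonneg _))
  · refine (hN m hm3 t y).trans (mul_le_mul_of_nonneg_right ?_ (omega_nonneg _ _))
    exact mul_le_mul_of_nonneg_right (le_max_right _ _) (by positivity)

end

/-! ### Growth estimates and existence of the decomposition. -/

namespace IsBalanced

variable {n s m : ℕ} {a : ℕ → ℕ → ℂ} {T : ℂ[X]} {ρ : Fin (s + 1) → ℝ} {γ C D : ℝ}
  (hb : IsBalanced n a T ρ m γ C D)

include hb

lemma isPerturbedOrbit (y : solutionSpace n a m) :
    IsPerturbedOrbit (root T) (γ / 3) fun t => solCoord n a T m t y := fun t i =>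
  (hb.step y t i).trans (mul_le_mul_of_nonneg_right (hb.small i t) (norm_nonneg _))

lemma norm_zero_le (y : solutionSpace n a m) :
    ‖solCoord n a T m 0 y‖ ≤ D * m * omega n (y : Set.Ici m → ℂ) (start m) :=
  hb.norm_le y 0

lemma omega_start_le (y : solutionSpace n a m) :
    omega n (y : Set.Ici m → ℂ) (start m) ≤ D * ‖solCoord n a T m 0 y‖ :=
  hb.omega_le y 0

/-- The summands of the growth decomposition. -/
lemma isInternal : DirectSum.IsInternal fun i => summand (solCoord n a T m) (root T) γ (ρ i) :=
  hb.spectrum.isInternal hb.γ_pos hb.isPerturbedOrbit hb.bijective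

lemma finrank_eq (i : Fin (s + 1)) :
    Module.finrank ℂ (summand (solCoord n a T m) (root T) γ (ρ i)) = multSum T (ρ i) := by
  rw [finrank_summand hb.γ_pos (hb.spectrum.isIsolated i) hb.isPerturbedOrbit
    (hb.spectrum.nonneg i) hb.bijective, ← card_filter_rootIndex]
  rfl

lemma le_slow {i j : Fin (s + 1)} (hij : i ≤ j) :
    summand (solCoord n a T m) (root T) γ (ρ j) ≤ slow (solCoord n a T m) (ρ i + γ) := by
  intro y hy
  refine slow_mono ?_ ?_ hy.1
  · linarith [hb.spectrum.nonneg j, hb.γ_pos]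
  · linarith [(hb.spectrum.strictAnti hb.γ_pos).antitone hij]

lemma upperSum_le (i : Fin (s + 1)) :
    upperSum (fun i => summand (solCoord n a T m) (root T) γ (ρ i)) i ≤
      slow (solCoord n a T m) (ρ i + γ) :=
  iSup_le fun _ => iSup_le fun hij => hb.le_slow hij

lemma norm_succ_le {i : Fin (s + 1)} {y : solutionSpace n a m}
    (hy : y ∈ slow (solCoord n a T m) (ρ i + γ)) (t : ℕ) :
    ‖solCoord n a T m (t + 1) y‖ ≤
      (ρ i + C * ((m + t : ℕ) : ℝ) ^ (-(1 / (multMax T (ρ i) : ℝ)))) *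
        ‖solCoord n a T m t y‖ := by
  have hC := hb.one_le_C
  refine norm_succ_le_of_mem_slow hb.γ_pos (hb.spectrum.isIsolated i) hb.isPerturbedOrbit
    (hb.spectrum.nonneg i) hy (by positivity) fun j hj => ?_
  rw [← hj]
  exact hb.step y t j

lemma two_mul_le (θ : Fin s) : 2 * γ ≤ ρ θ.castSucc := by
  linarith [hb.spectrum.gap _ _ (Fin.castSucc_lt_succ (i := θ)), hb.spectrum.nonneg θ.succ]

lemma pos (θ : Fin s) : 0 < ρ θ.castSucc := by
  linarith [hb.two_mul_le θ, hb.γ_pos]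

lemma exists_upper (he : ∀ i : Fin s, 0 < multSum T (ρ i.castSucc)) (θ : Fin s) :
    ∃ A₀ : ℝ, ∀ A, A₀ ≤ A → ∀ y ∈ slow (solCoord n a T m) (ρ θ.castSucc + γ), ∀ ν : Set.Ici m,
      omega n (y : Set.Ici m → ℂ) ν ≤ Real.exp (A * rate (multMax T (ρ θ.castSucc)) ν) *
        ρ θ.castSucc ^ (ν : ℕ) * omega n (y : Set.Ici m → ℂ) (start m) := by
  have hk := one_le_multMax_of_pos (he θ)
  have hq := hb.pos θ
  have hC := hb.one_le_C
  have hD := hb.one_le_D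
  have hm := hb.m_pos
  set q := ρ θ.castSucc
  -- Comparison of windows and coordinates at both ends gives D·(D·m); q^m appears because the orbit
  -- starts at m while the bound carries q^ν. Since the rate is at least 1, E is absorbed by
  -- exp(E·rate).
  set E := D * (D * m) / q ^ m with hE
  have hE0 : 0 ≤ E := by positivity
  refine ⟨4 * C / q + E, fun A hA y hy ν => ?_⟩
  obtain ⟨t, rfl⟩ := exists_eq_shift_start ν
  have h1 := le_pow_mul_exp_rate (N := fun t => ‖solCoord n a T m t y‖) hk hb.m_pos
    (fun _ => norm_nonneg _) hq (by linarith) (hb.norm_succ_le hy) t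
  have h2 := hb.omega_le y t
  have h3 := hb.norm_zero_le y
  have hr := one_le_rate (ν := m + t) hk (by omega)
  have hω := omega_nonneg (n := n) (y : Set.Ici m → ℂ) (start m)
  rw [coe_shift_start]
  calc _ ≤ D * (q ^ t * Real.exp (4 * C / q * rate (multMax T q) (m + t)) *
          (D * m * omega n (y : Set.Ici m → ℂ) (start m))) := by
        refine h2.trans (mul_le_mul_of_nonneg_left (h1.trans ?_) (by linarith))
        exact mul_le_mul_of_nonneg_left h3 (by positivity)
    _ = E * Real.exp (4 * C / q * rate (multMax T q) (m + t)) * q ^ (m + t) *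
          omega n (y : Set.Ici m → ℂ) (start m) := by
        rw [hE, pow_add]; field_simp
    _ ≤ _ := by
        refine mul_le_mul_of_nonneg_right (mul_le_mul_of_nonneg_right ?_ (by positivity)) hω
        calc _ ≤ Real.exp (E * rate (multMax T q) (m + t)) *
              Real.exp (4 * C / q * rate (multMax T q) (m + t)) :=
              mul_le_mul_of_nonneg_right (le_exp_mul hE0 hr) (Real.exp_pos _).le
          _ = Real.exp ((4 * C / q + E) * rate (multMax T q) (m + t)) := by
              rw [← Real.exp_add]; ring_nf
          _ ≤ _ := by
              rw [Real.exp_le_exp]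
              exact mul_le_mul_of_nonneg_right hA (by linarith)

lemma exists_lower (he : ∀ i : Fin s, 0 < multSum T (ρ i.castSucc)) (θ : Fin s) :
    ∃ A₀ : ℝ, ∀ A, A₀ ≤ A →
      ∀ y ∈ summand (solCoord n a T m) (root T) γ (ρ θ.castSucc), ∀ ν : Set.Ici m,
      Real.exp (-A * rate (multMax T (ρ θ.castSucc)) ν) * ρ θ.castSucc ^ (ν : ℕ) *
        omega n (y : Set.Ici m → ℂ) (start m) ≤ omega n (y : Set.Ici m → ℂ) ν := by
  have hk := one_le_multMax_of_pos (he θ)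
  have hq := hb.pos θ
  have hC := hb.one_le_C
  have hD := hb.one_le_D
  have hm := hb.m_pos
  have hγq := hb.two_mul_le θ
  have hγ := hb.γ_pos
  obtain ⟨i₀, hi₀⟩ := exists_rootIndex (he θ)
  set q := ρ θ.castSucc
  set E := D * D * q ^ m with hE
  have hE0 : 0 ≤ E := by positivity
  refine ⟨8 * C / q + 1 + E, fun A hA y hy ν => ?_⟩
  obtain ⟨t, rfl⟩ := exists_eq_shift_start ν
  have h1 := pow_mul_exp_rate_le (N := fun t => ‖solCoord n a T m t y‖) (q := q) (C := C) hk
    hb.m_pos (fun _ => norm_nonneg _) hq (by linarith)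
    -- Smallness at a root on this circle gives at most γ/3, and 2γ ≤ q.
    (fun t => by
      have := hb.small i₀ t
      rw [show ‖root T i₀‖ = q from hi₀] at this
      linarith)
    (fun t => le_norm_succ_of_mem_summand hγ (hb.spectrum.isIsolated θ.castSucc)
      hb.isPerturbedOrbit hγq hy fun j hj => by
        have := hb.step y t j
        rwa [show ‖root T j‖ = q from hj] at this) t
  have h2 := hb.norm_le y t
  have h3 := hb.omega_start_le y
  have hr := one_le_rate (ν := m + t) hk (by omega)
  have hlog := log_le_rate (multMax T q) (m + t)
  have hω := omega_nonneg (n := n) (y : Set.Ici m → ℂ) (start m)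
  have hν : (0 : ℝ) < (m + t : ℕ) := by exact_mod_cast (by omega : 0 < m + t)
  rw [coe_shift_start]
  set R := rate (multMax T q) (m + t)
  -- The factor m + t from the weights is at most exp(rate), because the rate contains the
  -- logarithm.
  have hexp : E * ((m + t : ℕ) : ℝ) * Real.exp (-A * R) ≤ Real.exp (-(8 * C / q) * R) := by
    calc _ ≤ Real.exp (E * R) * Real.exp R * Real.exp (-A * R) := by
          gcongr
          · exact le_exp_mul hE0 hr
          · rw [← Real.exp_log hν]
            exact Real.exp_le_exp.2 hlog
      _ = Real.exp ((E + 1 - A) * R) := by rw [← Real.exp_add, ← Real.exp_add]; ring_nf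
      _ ≤ _ := by
          rw [Real.exp_le_exp]
          exact mul_le_mul_of_nonneg_right (by linarith) (by linarith)
  have hfac : 0 < D * ((m + t : ℕ) : ℝ) := by positivity
  refine le_of_mul_le_mul_left ?_ hfac
  calc _ ≤ D * ((m + t : ℕ) : ℝ) * (Real.exp (-A * R) * q ^ (m + t) *
          (D * ‖solCoord n a T m 0 y‖)) := by gcongr
    _ = q ^ t * (E * ((m + t : ℕ) : ℝ) * Real.exp (-A * R)) * ‖solCoord n a T m 0 y‖ := by
        rw [hE, pow_add]; ring
    _ ≤ q ^ t * Real.exp (-(8 * C / q) * R) * ‖solCoord n a T m 0 y‖ := by gcongr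
    _ ≤ _ := h1
    _ ≤ _ := h2

lemma exists_decay (hlast : ρ (Fin.last s) = 0) :
    ∃ A₀ : ℝ, ∀ A, A₀ ≤ A → 0 < multMax T (ρ (Fin.last s)) →
      ∀ y ∈ summand (solCoord n a T m) (root T) γ (ρ (Fin.last s)), ∀ ν : Set.Ici m,
      ‖(y : Set.Ici m → ℂ) ν‖ ≤
        (A / ((ν : ℕ) : ℝ)) ^ (((ν : ℕ) : ℝ) / (multMax T (ρ (Fin.last s)) : ℝ)) *
          omega n (y : Set.Ici m → ℂ) (start m) := by
  rcases Nat.eq_zero_or_pos (multMax T (ρ (Fin.last s))) with h0 | hk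
  · exact ⟨0, fun A _ h => absurd h (by omega)⟩
  have hC := hb.one_le_C
  have hD := hb.one_le_D
  have hm := hb.m_pos
  have hm' : (1 : ℝ) ≤ m := by exact_mod_cast hm
  obtain ⟨B, hB, hdecay⟩ := exists_superexponential_decay hk hm hC
  set k := multMax T (ρ (Fin.last s)) with hkdef
  have hk' : (0 : ℝ) < k := by exact_mod_cast hk
  set E := D * (D * m) with hE
  have hDm : 1 ≤ D * m := one_le_mul_of_one_le_of_one_le hD hm'
  have hE1 : 1 ≤ E := one_le_mul_of_one_le_of_one_le hD hDm
  -- The k-th power turns into (E·B)^ν when raised to ν/k.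
  refine ⟨(E * B) ^ k, fun A hA _ y hy ν => ?_⟩
  have hA0 : 0 ≤ A := le_trans (by positivity) hA
  obtain ⟨t, rfl⟩ := exists_eq_shift_start ν
  have h1 := hdecay (fun t => ‖solCoord n a T m t y‖) (fun _ => norm_nonneg _) (fun t => by
    have := hb.norm_succ_le hy.1 t
    rwa [← hkdef, hlast, zero_add] at this) t
  have h2 := hb.omega_le y t
  have h3 := hb.norm_zero_le y
  have h4 := norm_le_omega (y : Set.Ici m → ℂ) (shift (start m) t)
    (show 0 < n from hb.n_pos)
  have hω := omega_nonneg (n := n) (y : Set.Ici m → ℂ) (start m)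
  rw [shift_zero] at h4
  rw [coe_shift_start]
  obtain ⟨ν, hν⟩ : ∃ ν, ν = m + t := ⟨_, rfl⟩
  have hν0 : (0 : ℝ) < ν := by exact_mod_cast (by omega : 0 < ν)
  rw [← hν] at h1 ⊢
  have h5 : (E * B) ^ ν ≤ A ^ ((ν : ℝ) / k) := by
    calc _ = ((E * B) ^ k) ^ ((ν : ℝ) / k) := by
          rw [← Real.rpow_natCast _ k, ← Real.rpow_mul (by positivity), mul_div_cancel₀ _ hk'.ne',
            Real.rpow_natCast]
      _ ≤ _ := Real.rpow_le_rpow (by positivity) hA (by positivity)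
  have h6 : E ≤ E ^ ν := le_self_pow₀ hE1 (by omega)
  calc _ ≤ D * (B ^ ν * (ν : ℝ) ^ (-((ν : ℝ) / k)) *
          (D * m * omega n (y : Set.Ici m → ℂ) (start m))) := by
        refine (h4.trans h2).trans (mul_le_mul_of_nonneg_left (h1.trans ?_) (by linarith))
        exact mul_le_mul_of_nonneg_left h3 (by positivity)
    _ = E * B ^ ν * (ν : ℝ) ^ (-((ν : ℝ) / k)) * omega n (y : Set.Ici m → ℂ) (start m) := by
        rw [hE]; ring
    _ ≤ E ^ ν * B ^ ν * (ν : ℝ) ^ (-((ν : ℝ) / k)) *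
          omega n (y : Set.Ici m → ℂ) (start m) := by gcongr
    _ ≤ A ^ ((ν : ℝ) / k) * (ν : ℝ) ^ (-((ν : ℝ) / k)) *
          omega n (y : Set.Ici m → ℂ) (start m) := by
        rw [← mul_pow]
        gcongr
    _ = _ := by
        rw [Real.div_rpow hA0 hν0.le, Real.rpow_neg hν0.le, ← div_eq_mul_inv]

/-- The components after the θ-th are geometrically smaller than ρ_θ^ν, relative to the initial
window of the whole element; this provides α. -/
lemma exists_tail_bound (θ : Fin s) :
    ∃ B : ℝ, 0 < B ∧ ∀ v ∈ summand (solCoord n a T m) (root T) γ (ρ θ.castSucc),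
      ∀ w ∈ slow (solCoord n a T m) (ρ θ.succ + γ), ∀ ν : Set.Ici m,
      omega n (w : Set.Ici m → ℂ) ν ≤
        B * (ρ θ.succ + γ) ^ (ν : ℕ) * omega n ((v + w : solutionSpace n a m) : Set.Ici m → ℂ)
          (start m) := by
  have hD := hb.one_le_D
  have hm := hb.m_pos
  have hr : 0 < ρ θ.succ + γ := by linarith [hb.spectrum.nonneg θ.succ, hb.γ_pos]
  refine ⟨D * (D * m) / (ρ θ.succ + γ) ^ m, by positivity, fun v hv w hw ν => ?_⟩
  obtain ⟨t, rfl⟩ := exists_eq_shift_start ν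
  have h1 := hb.omega_le w t
  have h2 := hb.spectrum.norm_le_of_mem_slow hb.γ_pos hb.isPerturbedOrbit hw t
  have h3 := hb.spectrum.norm_le_norm_add hb.γ_pos hb.isPerturbedOrbit hv hw
  have h4 := hb.norm_zero_le (v + w)
  rw [coe_shift_start]
  calc _ ≤ D * (D * m * omega n ((v + w : solutionSpace n a m) : Set.Ici m → ℂ) (start m) *
          (ρ θ.succ + γ) ^ t) := by
        refine h1.trans (mul_le_mul_of_nonneg_left (h2.trans ?_) (by linarith))
        exact mul_le_mul_of_nonneg_right (h3.trans h4) (by positivity)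
    _ = _ := by rw [pow_add]; field_simp

/-- A balanced equation has a growth decomposition. -/
theorem exists_isGrowthDecomposition (hlast : ρ (Fin.last s) = 0)
    (he : ∀ i : Fin s, 0 < multSum T (ρ i.castSucc)) :
    ∃ (A : ℝ) (α : ℕ → ℝ), IsGrowthDecomposition n s a T ρ A m α
      fun i => summand (solCoord n a T m) (root T) γ (ρ i) := by
  choose A₁ hA₁ using hb.exists_upper he
  choose A₂ hA₂ using hb.exists_lower he
  obtain ⟨A₃, hA₃⟩ := hb.exists_decay hlast
  obtain ⟨A, hA0, hAd, hAu, hAl⟩ : ∃ A : ℝ, 0 < A ∧ A₃ ≤ A ∧ (∀ θ, A₁ θ ≤ A) ∧ ∀ θ, A₂ θ ≤ A :=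
    ((eventually_gt_atTop 0).and ((eventually_ge_atTop A₃).and
      ((eventually_all.2 fun θ => eventually_ge_atTop (A₁ θ)).and
        (eventually_all.2 fun θ => eventually_ge_atTop (A₂ θ))))).exists
  choose B hB0 hB using hb.exists_tail_bound
  have hγ := hb.γ_pos
  -- The tail bound divided by the scale ρ_θ^ν exp(-A·rate). It tends to 0, as the rate is sublinear
  -- and ρ_{θ+1}+γ < ρ_θ.
  let β : Fin s → ℕ → ℝ := fun θ ν => B θ * (((ρ θ.succ + γ) / ρ θ.castSucc) ^ ν *
    Real.exp (A * rate (multMax T (ρ θ.castSucc)) ν))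
  have hβ0 : ∀ θ ν, 0 ≤ β θ ν := by
    intro θ ν
    have := hB0 θ
    have := hb.pos θ
    have : 0 ≤ ρ θ.succ + γ := by linarith [hb.spectrum.nonneg θ.succ]
    positivity
  -- The sum over θ makes one α serve all radii; the term 1/(ν+1) makes it positive even for s = 0.
  refine ⟨A, fun ν => 1 / ((ν : ℝ) + 1) + ∑ θ, β θ ν, hA0, hb.m_pos, fun ν _ => ?_, ?_,
    hb.isInternal, hb.finrank_eq, fun θ => hA₂ θ A (hAl θ),
    fun θ y hy => hA₁ θ A (hAu θ) y (hb.upperSum_le _ hy), fun θ y hy ν => ?_, hA₃ A hAd⟩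
  · have := Finset.sum_nonneg fun θ (_ : θ ∈ Finset.univ) => hβ0 θ ν
    positivity
  · have h1 : ∀ θ, Tendsto (β θ) atTop (𝓝 0) := by
      intro θ
      have hpos := hb.pos θ
      have hr : 0 < ρ θ.succ + γ := by linarith [hb.spectrum.nonneg θ.succ]
      have hlt : (ρ θ.succ + γ) / ρ θ.castSucc < 1 := by
        rw [div_lt_one hpos]
        linarith [hb.spectrum.gap _ _ (Fin.castSucc_lt_succ (i := θ))]
      simpa using (tendsto_pow_mul_exp_rate (one_le_multMax_of_pos (he θ)) (div_pos hr hpos) hlt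
        A).const_mul (B θ)
    simpa using tendsto_one_div_add_atTop_nhds_zero_nat.add
      (tendsto_finsetSum Finset.univ fun θ _ => h1 θ)
  · have hv := (proj hb.isInternal θ.castSucc y).2
    have hw := sub_proj_mem hb.isInternal (W := slow (solCoord n a T m) (ρ θ.succ + γ))
      (fun i hi => hb.le_slow (Fin.castSucc_lt_iff_succ_le.1 hi)) hy
    set v : solutionSpace n a m := (proj hb.isInternal θ.castSucc y).1
    have h1 := hA₂ θ A (hAl θ) v hv ν
    have h2 := hB θ v hv (y - v) hw ν
    rw [add_sub_cancel] at h2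
    have h3 : omega n (v : Set.Ici m → ℂ) ν ≤ omega n (y : Set.Ici m → ℂ) ν +
        omega n ((y - v : solutionSpace n a m) : Set.Ici m → ℂ) ν := by
      have := omega_sub_le (n := n) (y : Set.Ici m → ℂ)
        ((y - v : solutionSpace n a m) : Set.Ici m → ℂ) ν
      rwa [Submodule.coe_sub, sub_sub_cancel] at this
    have hpos := hb.pos θ
    have hωy := omega_nonneg (n := n) (y : Set.Ici m → ℂ) (start m)
    have h4 : β θ ν ≤ 1 / (((ν : ℕ) : ℝ) + 1) + ∑ θ, β θ ν := by
      have h5 := Finset.single_le_sum (fun θ _ => hβ0 θ ν) (Finset.mem_univ θ)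
      have : 0 ≤ 1 / (((ν : ℕ) : ℝ) + 1) := by positivity
      linarith
    have h6 : β θ ν * ρ θ.castSucc ^ (ν : ℕ) *
        Real.exp (-A * rate (multMax T (ρ θ.castSucc)) ν) = B θ * (ρ θ.succ + γ) ^ (ν : ℕ) := by
      simp only [β]
      rw [neg_mul, Real.exp_neg, div_pow]
      field_simp
    have h7 : 0 ≤ ρ θ.castSucc ^ (ν : ℕ) *
        Real.exp (-A * rate (multMax T (ρ θ.castSucc)) ν) := by positivity
    calc _ ≤ (omega n (v : Set.Ici m → ℂ) (start m) -
          β θ ν * omega n (y : Set.Ici m → ℂ) (start m)) *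
            (ρ θ.castSucc ^ (ν : ℕ) * Real.exp (-A * rate (multMax T (ρ θ.castSucc)) ν)) := by
          rw [mul_assoc]
          refine mul_le_mul_of_nonneg_right ?_ h7
          exact sub_le_sub_left (mul_le_mul_of_nonneg_right h4 hωy) _
      _ = Real.exp (-A * rate (multMax T (ρ θ.castSucc)) ν) * ρ θ.castSucc ^ (ν : ℕ) *
            omega n (v : Set.Ici m → ℂ) (start m) -
          β θ ν * ρ θ.castSucc ^ (ν : ℕ) *
            Real.exp (-A * rate (multMax T (ρ θ.castSucc)) ν) *
              omega n (y : Set.Ici m → ℂ) (start m) := by ring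
      _ ≤ _ := by
          rw [h6]
          linarith

end IsBalanced

/-! ### A moment at which one component dominates. -/

/-- Among finitely many geometric sequences with well separated ratios, one dominates all others
by a given factor at a suitable early time. -/
lemma exists_dominating {ι : Type*} [LinearOrder ι] {r w : ι → ℝ} {Q E : ℝ} {N : ℕ}
    (hr : ∀ i, 0 ≤ r i) (hw : ∀ i, 0 ≤ w i) (hQ : 1 ≤ Q) (hE : 1 ≤ E)
    (hsep : ∀ i j, i < j → Q * r j ≤ r i) (hN : E ^ 2 ≤ Q ^ N) (ν : ℕ) (S : Finset ι)
    (hS : S.Nonempty) :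
    ∃ t ≤ S.card * N, ∃ p ∈ S, ∀ j ∈ S, j ≠ p →
      E * (r j ^ (ν + t) * w j) ≤ r p ^ (ν + t) * w p := by
  induction S using Finset.induction_on_min with
  | empty => exact absurd hS Finset.not_nonempty_empty
  | insert a S ha ih =>
    have haS : a ∉ S := fun h => (ha a h).false
    rcases S.eq_empty_or_nonempty with rfl | hne
    · refine ⟨0, Nat.zero_le _, a, by simp, fun j hj hja => absurd (by simpa using hj) hja⟩
    obtain ⟨t, ht, p, hp, hdom⟩ := ih hne
    rw [Finset.card_insert_of_notMem haS, add_mul, one_mul]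
    by_cases hcase : E * (r a ^ (ν + t) * w a) ≤ r p ^ (ν + t) * w p
    · refine ⟨t, by omega, p, Finset.mem_insert_of_mem hp, fun j hj hjp => ?_⟩
      rcases Finset.mem_insert.1 hj with rfl | hj
      · exact hcase
      · exact hdom j hj hjp
    · push Not at hcase
      -- The new index a is the smallest, so its ratio is the largest. At ν+t it is behind by less
      -- than a factor E; N further steps gain at least E^2, which puts it ahead by E.
      refine ⟨t + N, by omega, a, Finset.mem_insert_self _ _, fun j hj hja => ?_⟩
      have hjS := (Finset.mem_insert.1 hj).resolve_left hja
      have hnn : ∀ i, 0 ≤ r i ^ (ν + t) * w i := fun i =>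
        mul_nonneg (pow_nonneg (hr i) _) (hw i)
      have hjp : r j ^ (ν + t) * w j ≤ r p ^ (ν + t) * w p := by
        rcases eq_or_ne j p with rfl | h
        · exact le_rfl
        · exact (le_mul_of_one_le_left (hnn j) hE).trans (hdom j hjS h)
      have h1 : E ^ 2 * r j ^ N ≤ r a ^ N := by
        calc _ ≤ Q ^ N * r j ^ N := mul_le_mul_of_nonneg_right hN (pow_nonneg (hr j) _)
          _ = (Q * r j) ^ N := (mul_pow _ _ _).symm
          _ ≤ _ := pow_le_pow_left₀ (mul_nonneg (by linarith) (hr j)) (hsep a j (ha j hjS)) N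
      have hrN := pow_nonneg (hr j) N
      rw [← add_assoc, pow_add _ (ν + t), pow_add _ (ν + t)]
      calc _ = E * r j ^ N * (r j ^ (ν + t) * w j) := by ring
        _ ≤ E * r j ^ N * (E * (r a ^ (ν + t) * w a)) :=
            mul_le_mul_of_nonneg_left (hjp.trans hcase.le) (by positivity)
        _ = E ^ 2 * r j ^ N * (r a ^ (ν + t) * w a) := by ring
        _ ≤ r a ^ N * (r a ^ (ν + t) * w a) := mul_le_mul_of_nonneg_right h1 (hnn a)
        _ = _ := by ring

lemma exists_ratio_gap {s : ℕ} {ρ : Fin (s + 1) → ℝ} (hρ : StrictAnti ρ) :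
    ∃ Q : ℝ, 1 < Q ∧ ∀ i j, i < j → Q * ρ j ≤ ρ i := by
  have h : ∀ᶠ Q : ℝ in 𝓝[>] 1, ∀ i j, i < j → Q * ρ j ≤ ρ i := by
    refine eventually_all.2 fun i => eventually_all.2 fun j => ?_
    by_cases hij : i < j
    · have hc : Tendsto (fun Q : ℝ => Q * ρ j) (𝓝[>] 1) (𝓝 (1 * ρ j)) :=
        (Continuous.tendsto (by fun_prop) 1).mono_left nhdsWithin_le_nhds
      filter_upwards [hc.eventually_lt_const (show 1 * ρ j < ρ i by simpa using hρ hij)]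
        with Q hQ _ using hQ.le
    · exact Eventually.of_forall fun Q h => absurd h hij
  obtain ⟨Q, h1, h2⟩ := (h.and self_mem_nhdsWithin).exists
  exact ⟨Q, h2, h1⟩

/-! ### Forward growth of solutions. -/

section Forward

variable {n m : ℕ} {a : ℕ → ℕ → ℂ} {aLim : ℕ → ℂ}

lemma exists_coeff_bound
    (ha : ∀ i ≤ n, (fun ν : ℕ => a i ν - aLim i) =O[atTop] (fun ν : ℕ => 1 / ((ν : ℝ) + 1))) :
    ∃ C : ℝ, 1 ≤ C ∧ ∀ ν, ∑ k ∈ Finset.range n, ‖a k ν‖ ≤ C := by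
  have hlim : Tendsto (fun ν => ∑ k ∈ Finset.range n, ‖a k ν‖) atTop
      (𝓝 (∑ k ∈ Finset.range n, ‖aLim k‖)) := by
    refine tendsto_finsetSum _ fun k hk => Tendsto.norm ?_
    have := (ha k (Finset.mem_range.1 hk).le).trans_tendsto tendsto_one_div_add_atTop_nhds_zero_nat
    simpa using this.add_const (aLim k)
  obtain ⟨C, hC⟩ := hlim.bddAbove_range
  exact ⟨max 1 C, le_max_left _ _, fun ν => le_max_of_le_right (hC ⟨ν, rfl⟩)⟩

/-- Bounded coefficients and leading coefficient 1 suffice. Read backwards it carries a lower bound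
from a later point to an earlier one, without dividing by the coefficient of y(ν). -/
lemma omega_shift_le (ha_lead : ∀ ν : ℕ, a n ν = 1) {C : ℝ} (hC1 : 1 ≤ C)
    (hC : ∀ ν, ∑ k ∈ Finset.range n, ‖a k ν‖ ≤ C) {y : Set.Ici m → ℂ}
    (hy : y ∈ solutionSpace n a m) (ν : Set.Ici m) (t : ℕ) :
    omega n y (shift ν t) ≤ C ^ t * omega n y ν := by
  induction t with
  | zero => simp [shift_zero]
  | succ t ih =>
    have hω := omega_nonneg (n := n) y (shift ν t)
    have hstep : omega n y (shift ν (t + 1)) ≤ C * omega n y (shift ν t) := by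
      refine omega_le (by positivity) fun j hj => ?_
      rw [← shift_shift, shift_shift _ 1 j]
      rcases Nat.lt_or_ge (1 + j) n with h | h
      · exact (norm_le_omega y _ h).trans (le_mul_of_one_le_left hω hC1)
      · obtain rfl : n = 1 + j := by omega
        rw [solution_apply_add ha_lead hy, norm_neg]
        refine (norm_sum_le _ _).trans (le_trans ?_ (mul_le_mul_of_nonneg_right
          (hC (shift ν t : Set.Ici m)) hω))
        rw [Finset.sum_mul]
        refine Finset.sum_le_sum fun k hk => ?_
        rw [norm_mul]
        exact mul_le_mul_of_nonneg_left (norm_le_omega y _ (Finset.mem_range.1 hk)) (norm_nonneg _)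
    rw [pow_succ', mul_assoc]
    exact hstep.trans (mul_le_mul_of_nonneg_left ih (by linarith))

/-- A lower bound valid from some point on extends to the whole half-line. -/
lemma exists_lower_of_eventually (ha_lead : ∀ ν : ℕ, a n ν = 1) {C : ℝ} (hC1 : 1 ≤ C)
    (hC : ∀ ν, ∑ k ∈ Finset.range n, ‖a k ν‖ ≤ C) {k : ℕ} (hk : 1 ≤ k) (hm : 1 ≤ m) {q A : ℝ}
    (hq : 0 < q) (hA : 0 ≤ A) {W : Submodule ℂ (solutionSpace n a m)} {ν₀ : ℕ}
    (h : ∀ y ∈ W, ∀ ν : Set.Ici m, ν₀ ≤ ν → Real.exp (-A * rate k ν) * q ^ (ν : ℕ) *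
      omega n (y : Set.Ici m → ℂ) (start m) ≤ omega n (y : Set.Ici m → ℂ) ν) :
    ∃ A' : ℝ, 0 < A' ∧ ∀ y ∈ W, ∀ ν : Set.Ici m, Real.exp (-A' * rate k ν) * q ^ (ν : ℕ) *
      omega n (y : Set.Ici m → ℂ) (start m) ≤ omega n (y : Set.Ici m → ℂ) ν := by
  obtain ⟨M, hM⟩ : ∃ M, M = m + ν₀ := ⟨_, rfl⟩
  -- The lower bound at M, carried back to any ν < M. The addition R/c to the exponent then makes
  -- the required bound at most c for these finitely many ν.
  set c := Real.exp (-A * rate k M) * q ^ M / C ^ M with hc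
  have hc0 : 0 < c := by positivity
  set R := max 1 q ^ M with hR
  have hR0 : 0 < R := by positivity
  refine ⟨A + R / c, by positivity, fun y hy ν => ?_⟩
  have hν1 : 1 ≤ (ν : ℕ) := hm.trans ν.2
  have hr := one_le_rate hk hν1
  have hω := omega_nonneg (n := n) (y : Set.Ici m → ℂ) (start m)
  rcases Nat.lt_or_ge (ν : ℕ) M with hlt | hge
  · have h1 := omega_shift_le ha_lead hC1 hC y.2 ν (M - ν)
    have h2 := h y hy (shift ν (M - ν)) (by rw [coe_shift]; omega)
    rw [coe_shift, Nat.add_sub_cancel' hlt.le] at h2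
    have h3 : C ^ (M - (ν : ℕ)) ≤ C ^ M := pow_le_pow_right₀ hC1 (Nat.sub_le _ _)
    have h4 : c * omega n (y : Set.Ici m → ℂ) (start m) ≤ omega n (y : Set.Ici m → ℂ) ν := by
      rw [hc, div_mul_eq_mul_div, div_le_iff₀ (by positivity), mul_comm _ (C ^ M)]
      exact h2.trans (h1.trans (mul_le_mul_of_nonneg_right h3 (omega_nonneg _ _)))
    refine le_trans (mul_le_mul_of_nonneg_right ?_ hω) h4
    have h5 : q ^ (ν : ℕ) ≤ R :=
      (pow_le_pow_left₀ hq.le (le_max_right 1 q) _).trans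
        (pow_le_pow_right₀ (le_max_left 1 q) hlt.le)
    have h6 := le_exp_mul (show 0 ≤ R / c by positivity) hr
    have h7 : Real.exp (-(A + R / c) * rate k ν) ≤ (Real.exp (R / c * rate k ν))⁻¹ := by
      rw [← Real.exp_neg, Real.exp_le_exp]
      have := mul_nonneg hA (show 0 ≤ rate k ν by linarith)
      linarith
    calc _ ≤ (R / c)⁻¹ * R := by
          refine mul_le_mul (h7.trans ?_) h5 (by positivity) (by positivity)
          exact inv_anti₀ (by positivity) h6
      _ = c := by field_simp
  · refine le_trans ?_ (h y hy ν (by omega))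
    refine mul_le_mul_of_nonneg_right (mul_le_mul_of_nonneg_right ?_ (by positivity)) hω
    rw [Real.exp_le_exp]
    have := mul_nonneg (show 0 ≤ R / c by positivity) (show 0 ≤ rate k ν by linarith)
    linarith

end Forward

/-! ### Lower bound on the sum of the first summands. -/

namespace IsGrowthDecomposition

variable {n s m : ℕ} {a : ℕ → ℕ → ℂ} {T : ℂ[X]} {ρ : Fin (s + 1) → ℝ} {A : ℝ} {α : ℕ → ℝ}
  {V : Fin (s + 1) → Submodule ℂ (solutionSpace n a m)}

/-- The largest multiplicity of a nonzero root. -/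
local notation "kmax" => Finset.univ.sup fun i : Fin s => multMax T (ρ (Fin.castSucc i))

/-- If one component of `y` dominates the others at `ν'`, then `y` is as large as that
component. -/
lemma lower_of_dominating (h : IsGrowthDecomposition n s a T ρ A m α V)
    (he : ∀ i : Fin s, 0 < multSum T (ρ i.castSucc)) (hρ : StrictAnti ρ)
    (hlast : ρ (Fin.last s) = 0) {θ : Fin s} {y : solutionSpace n a m}
    (hy : y ∈ lowerSum V θ.castSucc) {ν' : Set.Ici m} {g : ℝ} (hg : 1 ≤ g)
    (hrate : rate kmax ν' ≤ 4 * g) {p : Fin (s + 1)} (hp : p ≤ θ.castSucc)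
    (hdom : ∀ j, j ≤ θ.castSucc → j ≠ p → Real.exp ((8 * A + 2 * (s + 1)) * g) *
      (ρ j ^ (ν' : ℕ) * omega n ((proj h.isInternal j y : solutionSpace n a m) : Set.Ici m → ℂ)
        (start m)) ≤ ρ p ^ (ν' : ℕ) *
        omega n ((proj h.isInternal p y : solutionSpace n a m) : Set.Ici m → ℂ) (start m)) :
    ρ θ.castSucc ^ (ν' : ℕ) * omega n (y : Set.Ici m → ℂ) (start m) ≤
      2 * (s + 1) * Real.exp (4 * A * g) * omega n (y : Set.Ici m → ℂ) ν' := by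
  have hA := h.A_pos
  set x : Fin (s + 1) → solutionSpace n a m := fun j => (proj h.isInternal j y).1 with hx
  set S := Finset.Iic θ.castSucc with hS
  have hsum : y = ∑ j ∈ S, x j := by
    conv_lhs => rw [← sum_proj h.isInternal y]
    refine (Finset.sum_subset (Finset.subset_univ _) fun j _ hj => ?_).symm
    rw [hS, Finset.mem_Iic, not_le] at hj
    rw [proj_eq_zero_of_mem_lowerSum h.isInternal hj hy]
    rfl
  have hcoe : ∀ S' : Finset (Fin (s + 1)), ((∑ j ∈ S', x j : solutionSpace n a m) :
      Set.Ici m → ℂ) = ∑ j ∈ S', (x j : Set.Ici m → ℂ) := fun S' => Submodule.coe_sum _ _ _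
  have hν1 : 1 ≤ (ν' : ℕ) := h.m_pos.trans ν'.2
  have hρ0 : ∀ j, 0 ≤ ρ j := fun j => by
    rw [← hlast]
    exact hρ.antitone (Fin.le_last j)
  have hcast : ∀ j, j ≤ θ.castSucc → ∃ j' : Fin s, j = j'.castSucc := fun j hj =>
    ⟨j.castLT (lt_of_le_of_lt (Fin.le_def.1 hj) θ.2), rfl⟩
  set d : Fin (s + 1) → ℝ := fun j => ρ j ^ (ν' : ℕ) * omega n (x j : Set.Ici m → ℂ) (start m)
    with hd
  have hd0 : ∀ j, 0 ≤ d j := fun j => mul_nonneg (pow_nonneg (hρ0 j) _) (omega_nonneg _ _)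
  have hratej : ∀ j : Fin s, A * rate (multMax T (ρ j.castSucc)) ν' ≤ 4 * A * g := by
    intro j
    have h1 := rate_mono (one_le_multMax_of_pos (he j))
      (Finset.le_sup (f := fun i : Fin s => multMax T (ρ i.castSucc)) (Finset.mem_univ j)) hν1
    have := mul_le_mul_of_nonneg_left (h1.trans hrate) hA.le
    linarith
  have hup : ∀ j, j ≤ θ.castSucc → omega n (x j : Set.Ici m → ℂ) ν' ≤
      Real.exp (4 * A * g) * d j := by
    intro j hj
    obtain ⟨j', rfl⟩ := hcast j hj
    have hmem : x j'.castSucc ∈ upperSum V j'.castSucc :=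
      Submodule.mem_iSup_of_mem j'.castSucc (Submodule.mem_iSup_of_mem le_rfl
        (proj h.isInternal j'.castSucc y).2)
    refine (h.upper j' _ hmem ν').trans ?_
    rw [mul_assoc]
    exact mul_le_mul_of_nonneg_right (Real.exp_le_exp.2 (hratej j')) (hd0 _)
  have hlow : Real.exp (-(4 * A * g)) * d p ≤ omega n (x p : Set.Ici m → ℂ) ν' := by
    obtain ⟨p', rfl⟩ := hcast p hp
    refine le_trans ?_ (h.lower p' _ (proj h.isInternal p'.castSucc y).2 ν')
    rw [mul_assoc (Real.exp (-A * _))]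
    refine mul_le_mul_of_nonneg_right (Real.exp_le_exp.2 ?_) (hd0 _)
    linarith [hratej p']
  have hpS : p ∈ S := Finset.mem_Iic.2 hp
  have hs0 : (0 : ℝ) < s + 1 := by positivity
  have hcard : (S.card : ℝ) ≤ s + 1 := by
    have := Finset.card_le_univ S
    rw [Fintype.card_fin] at this
    exact_mod_cast this
  have hcard' : ((S.erase p).card : ℝ) ≤ s + 1 :=
    le_trans (by exact_mod_cast Finset.card_le_card (Finset.erase_subset p S)) hcard
  set E := Real.exp ((8 * A + 2 * (s + 1)) * g) with hE
  have hE1 : 1 ≤ E := Real.one_le_exp (by positivity)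
  set e := Real.exp (4 * A * g) with he'
  have he0 : 0 < e := Real.exp_pos _
  -- One factor e is lost in the upper bound of each other component, one in the lower bound of the
  -- dominating one; 2(s+1) makes the others together at most half of it.
  have hEe : 2 * (s + 1) * (e * e) ≤ E := by
    have h1 := le_exp_mul (D := 2 * ((s : ℝ) + 1)) (by positivity) hg
    calc _ ≤ Real.exp (2 * ((s : ℝ) + 1) * g) * (e * e) :=
          mul_le_mul_of_nonneg_right h1 (by positivity)
      _ = E := by rw [he', hE, ← Real.exp_add, ← Real.exp_add]; ring_nf
  rw [Real.exp_neg, inv_mul_le_iff₀ he0] at hlow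
  have hrest : e * ∑ j ∈ S.erase p, omega n (x j : Set.Ici m → ℂ) ν' ≤ d p / 2 := by
    have h1 : ∀ j ∈ S.erase p, e * omega n (x j : Set.Ici m → ℂ) ν' ≤ d p / (2 * (s + 1)) := by
      intro j hj
      have hjS := Finset.mem_Iic.1 (Finset.mem_of_mem_erase hj)
      rw [le_div_iff₀ (by positivity)]
      calc _ ≤ e * (e * d j) * (2 * (s + 1)) := by
            refine mul_le_mul_of_nonneg_right ?_ (by positivity)
            exact mul_le_mul_of_nonneg_left (hup j hjS) he0.le
        _ = 2 * (s + 1) * (e * e) * d j := by ring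
        _ ≤ E * d j := mul_le_mul_of_nonneg_right hEe (hd0 j)
        _ ≤ _ := hdom j hjS (Finset.ne_of_mem_erase hj)
    rw [Finset.mul_sum]
    refine (Finset.sum_le_card_nsmul _ _ _ h1).trans ?_
    rw [nsmul_eq_mul]
    calc _ ≤ ((s : ℝ) + 1) * (d p / (2 * (s + 1))) :=
          mul_le_mul_of_nonneg_right hcard' (div_nonneg (hd0 p) (by positivity))
      _ = d p / 2 := by field_simp
  have hmain : d p ≤ 2 * e * omega n (y : Set.Ici m → ℂ) ν' := by
    have h1 : (x p : Set.Ici m → ℂ) = y - ∑ j ∈ S.erase p, (x j : Set.Ici m → ℂ) := by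
      rw [hsum, hcoe, ← Finset.add_sum_erase _ _ hpS, add_sub_cancel_right]
    have h2 := omega_sub_le (n := n) (y : Set.Ici m → ℂ)
      (∑ j ∈ S.erase p, (x j : Set.Ici m → ℂ)) ν'
    rw [← h1] at h2
    have h3 := omega_sum_le (n := n) (S.erase p) (fun j => (x j : Set.Ici m → ℂ)) ν'
    have h4 := mul_le_mul_of_nonneg_left (h2.trans (add_le_add_right h3 _)) he0.le
    linarith
  -- Every component present has index at most θ, hence a radius at least ρ_θ.
  have hstart : ρ θ.castSucc ^ (ν' : ℕ) * omega n (y : Set.Ici m → ℂ) (start m) ≤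
      (s + 1) * d p := by
    have h1 : ∀ j ∈ S, ρ θ.castSucc ^ (ν' : ℕ) * omega n (x j : Set.Ici m → ℂ) (start m) ≤
        d p := by
      intro j hj
      have hjS := Finset.mem_Iic.1 hj
      refine le_trans (mul_le_mul_of_nonneg_right
        (pow_le_pow_left₀ (hρ0 _) (hρ.antitone hjS) _) (omega_nonneg _ _)) ?_
      change d j ≤ d p
      rcases eq_or_ne j p with rfl | hjp
      · exact le_rfl
      · exact (le_mul_of_one_le_left (hd0 j) hE1).trans (hdom j hjS hjp)
    have h2 := omega_sum_le (n := n) S (fun j => (x j : Set.Ici m → ℂ)) (start m)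
    rw [← hcoe, ← hsum] at h2
    refine (mul_le_mul_of_nonneg_left h2 (pow_nonneg (hρ0 _) _)).trans ?_
    rw [Finset.mul_sum]
    refine (Finset.sum_le_card_nsmul _ _ _ h1).trans ?_
    rw [nsmul_eq_mul]
    exact mul_le_mul_of_nonneg_right hcard (hd0 p)
  calc _ ≤ _ := hstart
    _ ≤ (s + 1) * (2 * e * omega n (y : Set.Ici m → ℂ) ν') :=
        mul_le_mul_of_nonneg_left hmain hs0.le
    _ = _ := by ring

theorem exists_lower_lowerSum (h : IsGrowthDecomposition n s a T ρ A m α V)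
    (he : ∀ i : Fin s, 0 < multSum T (ρ i.castSucc)) (hρ : StrictAnti ρ)
    (hlast : ρ (Fin.last s) = 0) (ha_lead : ∀ ν : ℕ, a n ν = 1) {C : ℝ} (hC1 : 1 ≤ C)
    (hC : ∀ ν, ∑ k ∈ Finset.range n, ‖a k ν‖ ≤ C) (θ : Fin s) :
    ∃ A' : ℝ, 0 < A' ∧ ∀ y ∈ lowerSum V θ.castSucc, ∀ ν : Set.Ici m,
      Real.exp (-A' * rate kmax ν) * ρ θ.castSucc ^ (ν : ℕ) *
        omega n (y : Set.Ici m → ℂ) (start m) ≤ omega n (y : Set.Ici m → ℂ) ν := by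
  have hA := h.A_pos
  have hk : 1 ≤ kmax := (one_le_multMax_of_pos (he θ)).trans
    (Finset.le_sup (f := fun i : Fin s => multMax T (ρ i.castSucc)) (Finset.mem_univ θ))
  obtain ⟨Q, hQ1, hQ⟩ := exists_ratio_gap hρ
  have hρ0 : ∀ j, 0 ≤ ρ j := fun j => by
    rw [← hlast]
    exact hρ.antitone (Fin.le_last j)
  have hq : 0 < ρ θ.castSucc := by
    rw [← hlast]
    exact hρ (Fin.castSucc_lt_last θ)
  set q := ρ θ.castSucc with hqdef
  set b := 8 * A + 2 * ((s : ℝ) + 1) with hb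
  have hb0 : 0 < b := by positivity
  have hlogQ := Real.log_pos hQ1
  -- The waiting time is at most (s+1)·N ≤ c·g. Beyond ν₀ it is at most ν, so the rate at the later
  -- point is at most 4g.
  set c := ((s : ℝ) + 1) * (2 * b / Real.log Q + 1) with hc
  have hc0 : 0 < c := by positivity
  have hlim := (tendsto_rate_div hk).eventually_le_const (show 0 < 1 / c by positivity)
  obtain ⟨ν₀, hν₀⟩ := eventually_atTop.1 hlim
  -- The forward growth C^t is measured against q^t, which cancels in the final estimate.
  set l := max 1 (C / q) with hl
  have hl1 : 1 ≤ l := le_max_left _ _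
  have hlogl := Real.log_nonneg hl1
  refine exists_lower_of_eventually (ν₀ := ν₀) (A := 2 * ((s : ℝ) + 1) + 4 * A + c * Real.log l)
    ha_lead hC1 hC hk h.m_pos hq (by positivity) fun y hy ν hν => ?_
  have hν1 : 1 ≤ (ν : ℕ) := h.m_pos.trans ν.2
  have hνpos : (0 : ℝ) < (ν : ℕ) := by exact_mod_cast hν1
  have hg := one_le_rate hk hν1
  have hcg := hν₀ ν hν
  set g := rate kmax ν with hgdef
  rw [div_le_div_iff₀ hνpos hc0, one_mul] at hcg
  -- The least N with Q^N ≥ exp(b·g)^2, as `exists_dominating` requires.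
  set N := ⌈2 * b * g / Real.log Q⌉₊ with hN
  have hN1 : 2 * b * g / Real.log Q ≤ N := Nat.le_ceil _
  have hN2 : (N : ℝ) < 2 * b * g / Real.log Q + 1 := Nat.ceil_lt_add_one (by positivity)
  have hpow : Real.exp (b * g) ^ 2 ≤ Q ^ N := by
    rw [← Real.exp_nat_mul, ← Real.rpow_natCast, Real.rpow_def_of_pos (by linarith),
      Real.exp_le_exp]
    rw [div_le_iff₀ hlogQ] at hN1
    push_cast
    linarith
  obtain ⟨t, ht, p, hp, hdom⟩ := exists_dominating (r := ρ)
    (w := fun j => omega n ((proj h.isInternal j y : solutionSpace n a m) : Set.Ici m → ℂ)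
      (start m)) hρ0 (fun _ => omega_nonneg _ _) hQ1.le
    (Real.one_le_exp (show 0 ≤ b * g by positivity)) hQ hpow ν (Finset.Iic θ.castSucc)
    ⟨θ.castSucc, Finset.mem_Iic.2 le_rfl⟩
  have htc : (t : ℝ) ≤ c * g := by
    have hcard : (Finset.Iic θ.castSucc).card ≤ s + 1 := by
      have := Finset.card_le_univ (Finset.Iic θ.castSucc)
      rwa [Fintype.card_fin] at this
    have h1 : (t : ℝ) ≤ ((s : ℝ) + 1) * N := by
      exact_mod_cast ht.trans (Nat.mul_le_mul_right N hcard)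
    refine h1.trans ?_
    rw [hc, mul_assoc]
    refine mul_le_mul_of_nonneg_left ?_ (by positivity)
    have : (2 * b / Real.log Q + 1) * g = 2 * b * g / Real.log Q + g := by ring
    linarith
  have hrate : rate kmax (shift ν t : Set.Ici m) ≤ 4 * g := by
    have := rate_le_mul (k := kmax) (ν := (ν : ℕ)) (ν' := (shift ν t : Set.Ici m)) (c := 2) hk hν1
      (h.m_pos.trans (shift ν t).2) (by norm_num)
      (by rw [coe_shift]; push_cast; linarith)
    linarith
  have h1 := h.lower_of_dominating he hρ hlast hy hg hrate (Finset.mem_Iic.1 hp)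
    fun j hj hjp => hdom j (Finset.mem_Iic.2 hj) hjp
  rw [coe_shift] at h1
  have h2 := omega_shift_le ha_lead hC1 hC y.2 ν t
  have hω := omega_nonneg (n := n) (y : Set.Ici m → ℂ) ν
  have hCl : C ^ t ≤ q ^ t * l ^ t := by
    rw [← mul_pow]
    refine pow_le_pow_left₀ (by linarith) ?_ t
    rw [mul_comm, ← div_le_iff₀ hq]
    exact le_max_right _ _
  have hlt : l ^ t ≤ Real.exp (c * Real.log l * g) := by
    rw [← Real.rpow_natCast, Real.rpow_def_of_pos (by linarith), Real.exp_le_exp]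
    have := mul_le_mul_of_nonneg_left htc hlogl
    linarith
  have h3 : q ^ (ν : ℕ) * omega n (y : Set.Ici m → ℂ) (start m) ≤
      Real.exp ((2 * ((s : ℝ) + 1) + 4 * A + c * Real.log l) * g) *
        omega n (y : Set.Ici m → ℂ) ν := by
    refine le_of_mul_le_mul_left ?_ (pow_pos hq t)
    calc _ = q ^ ((ν : ℕ) + t) * omega n (y : Set.Ici m → ℂ) (start m) := by
          rw [pow_add]; ring
      _ ≤ _ := h1
      _ ≤ Real.exp (2 * ((s : ℝ) + 1) * g) * Real.exp (4 * A * g) *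
            (q ^ t * Real.exp (c * Real.log l * g) * omega n (y : Set.Ici m → ℂ) ν) := by
          have h4 := le_exp_mul (D := 2 * ((s : ℝ) + 1)) (by positivity) hg
          have h5 : C ^ t ≤ q ^ t * Real.exp (c * Real.log l * g) :=
            hCl.trans (mul_le_mul_of_nonneg_left hlt (by positivity))
          refine mul_le_mul (mul_le_mul_of_nonneg_right h4 (Real.exp_pos _).le)
            (h2.trans (mul_le_mul_of_nonneg_right h5 hω)) (omega_nonneg _ _) (by positivity)
      _ = q ^ t * (Real.exp (2 * ((s : ℝ) + 1) * g) * Real.exp (4 * A * g) *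
            Real.exp (c * Real.log l * g) * omega n (y : Set.Ici m → ℂ) ν) := by ring
      _ = _ := by
          rw [← Real.exp_add, ← Real.exp_add]
          ring_nf
  rw [neg_mul, Real.exp_neg, mul_assoc, inv_mul_le_iff₀ (Real.exp_pos _)]
  exact h3

end IsGrowthDecomposition

end PoincareEq

theorem theorem8 (s n : ℕ) (hn : 1 ≤ n) (a : ℕ → ℕ → ℂ) (aLim : ℕ → ℂ)
    (ha_lead : ∀ ν : ℕ, a n ν = 1)
    (ha : ∀ i ≤ n, (fun ν : ℕ => a i ν - aLim i) =O[atTop] (fun ν : ℕ => 1 / ((ν : ℝ) + 1)))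
    (ρ : Fin (s + 1) → ℝ) (hρ : StrictAnti ρ) (hρ_last : ρ (Fin.last s) = 0)
    (hroots : ∀ z ∈ (charPol n aLim).roots, ∃ i : Fin (s + 1), ‖z‖ = ρ i)
    (he : ∀ i : Fin s, 0 < multSum (charPol n aLim) (ρ i.castSucc)) :
    (∃ (A : ℝ) (m : ℕ) (α : ℕ → ℝ) (V : Fin (s + 1) → Submodule ℂ (solutionSpace n a m)),
        IsGrowthDecomposition n s a (charPol n aLim) ρ A m α V) ∧
    ∀ (A : ℝ) (m : ℕ) (α : ℕ → ℝ) (V : Fin (s + 1) → Submodule ℂ (solutionSpace n a m)),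
      IsGrowthDecomposition n s a (charPol n aLim) ρ A m α V →
      ∀ θ : Fin s, ∃ Astar : ℝ, 0 < Astar ∧
        ∀ y ∈ lowerSum V θ.castSucc, ∀ ν : Set.Ici m,
          Real.exp (-Astar *
              rate (Finset.univ.sup fun i : Fin s => multMax (charPol n aLim) (ρ i.castSucc)) ν)
            * ρ θ.castSucc ^ (ν : ℕ) * omega n (y : Set.Ici m → ℂ) (start m)
          ≤ omega n (y : Set.Ici m → ℂ) ν := by
  refine ⟨?_, fun A m α V h θ => ?_⟩
  · obtain ⟨m, γ, C, D, hb⟩ := exists_isBalanced hn ha_lead ha hρ hρ_last hroots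
    obtain ⟨A, α, h⟩ := hb.exists_isGrowthDecomposition hρ_last he
    exact ⟨A, m, α, _, h⟩
  · obtain ⟨C, hC1, hC⟩ := exists_coeff_bound ha
    exact h.exists_lower_lowerSum he hρ hρ_last ha_lead hC1 hC θ
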